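/- A \emph{tournament} is a finite digraph obtained by choosing a direction for every edge of a complete graph; its \emph{order} is its number of vertices. A \emph{rooted tree} is a directed tree with a special vertex, the \emph{root}, such that there is a unique directed path from the root to any other vertex; a \emph{leaf} is a vertex of out-degree zero. For a positive integer $k$, a \emph{$k$-ary tree} is a rooted tree in which all non-leaf vertices have exactly $k$ children, except that possibly one non-leaf vertex has at most $k-1$ children. A $k$-ary spanning tree of a tournament $T$ is a subdigraph of $T$ that contains all vertices of $T$ and is a $k$-ary tree. Let $h(k)$ be the minimum integer $N$ such that every tournament of order at least $N$ contains a $k$-ary spanning tree (when such an $N$ exists). Theorem. $h(4)=10$; and $h(5)$ exists and satisfies $h(5)\ge 13$. That is: every tournament of order at least $10$ contains a $4$-ary spanning tree, and $10$ is the smallest integer with this property; and some integer $N$ has the property that every tournament of order at least $N$ contains a $5$-ary spanning tree, and every such $N$ is at least $13$. -/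

import Mathlib

namespace Digraph

variable {V : Type*}

/-- A tournament: an orientation of the complete graph on `V`, i.e. a loopless digraph in which
exactly one of the arcs `(x, y)`, `(y, x)` is present for any two distinct vertices `x`, `y`. -/
def IsTournament (T : Digraph V) : Prop :=
  (∀ x, ¬ T.Adj x x) ∧ ∀ x y, x ≠ y → Xor (T.Adj x y) (T.Adj y x)

/-- The number of out-neighbours (in a rooted tree: of children) of `v`. A vertex is a leaf
if this number is zero. -/
noncomputable def outDeg (R : Digraph V) (v : V) : ℕ :=
  {w | R.Adj v w}.ncard

/-- `p` is the list of vertices of a directed path in `R` from `x` to `y`. -/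
def IsDiPath (R : Digraph V) (x y : V) (p : List V) : Prop :=
  p.head? = some x ∧ p.getLast? = some y ∧ p.IsChain R.Adj ∧ p.Nodup

/-- A directed tree with vertex set `V`: a digraph without loops and without pairs of opposite
arcs whose underlying undirected graph is a tree. -/
def IsDirectedTree (R : Digraph V) : Prop :=
  (∀ x y, R.Adj x y → ¬ R.Adj y x) ∧ R.toSimpleGraphInclusive.IsTree

/-- A rooted tree with vertex set `V` and root `r`: a directed tree in which there is a unique
directed path from `r` to any other vertex. -/
def IsRootedTree (R : Digraph V) (r : V) : Prop :=
  R.IsDirectedTree ∧ ∀ v, v ≠ r → ∃! p : List V, R.IsDiPath r v p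

/-- A `k`-ary tree with vertex set `V`: a rooted tree in which all non-leaf vertices have exactly
`k` children, except possibly one non-leaf vertex, which has fewer than `k` children. -/
def IsKAryTree (R : Digraph V) (k : ℕ) : Prop :=
  (∃ r, R.IsRootedTree r) ∧
    (∀ v, R.outDeg v ≠ 0 → R.outDeg v = k ∨ R.outDeg v < k) ∧
    {v | R.outDeg v ≠ 0 ∧ R.outDeg v ≠ k}.Subsingleton

/-- `T` contains a `k`-ary spanning tree: a subdigraph on the whole vertex set that is a
`k`-ary tree. -/
def HasKArySpanningTree (T : Digraph V) (k : ℕ) : Prop :=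
  ∃ R : Digraph V, R ≤ T ∧ R.IsKAryTree k

end Digraph

/-- Every (finite) tournament of order at least `N` contains a `k`-ary spanning tree. -/
def EveryTournamentHasKArySpanningTree (k N : ℕ) : Prop :=
  ∀ (V : Type) [Fintype V], N ≤ Fintype.card V →
    ∀ T : Digraph V, T.IsTournament → T.HasKArySpanningTree k

/-- `hNum k` is the minimum integer `N` such that every tournament of order at least `N` contains a
`k`-ary spanning tree. (If there were no such `N`, this would be `0`; so a positive lower bound
on `hNum k` includes the existence of such an `N`.) -/
noncomputable def hNum (k : ℕ) : ℕ :=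
  sInf {N | EveryTournamentHasKArySpanningTree k N}

open Finset

/-! ### Out-trees given by parent functions, and two ways to enlarge them -/

namespace Digraph

variable {V : Type*}

/-! Lower bounds. A `4`-ary tree on `9` vertices has exactly two non-leaves `a`, `b`. A common
in-neighbour of `a` and `b` is neither of them, so it is a leaf whose parent would have to be `a` or
`b`, which is impossible. Doubling two vertices of the Paley tournament on `7` vertices makes every
pair dominated. On `12` vertices a `5`-ary tree has one further non-leaf with a single child, and
two common in-neighbours are needed; doubling one vertex of the Paley tournament on `11` vertices
provides them.

Existence for `k = 5`. A huge tournament contains a long transitive list, which hangs below one leaf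
of a small tree and can absorb any bounded number of stubborn vertices. All other vertices are added
`k` at a time: either `k` of them go below a second leaf, or a star among them is inserted into the
tree (`HasOutTree.insert_star`). This handles orders that are `1` modulo `k`; for the other residues
one deficient star is inserted at the end.

Upper bound `10` for `k = 4`. Inserting a star reduces order `n` to `n - 4`, so the orders `9 + c`
with `1 ≤ c ≤ 4` remain. There a tree with three prescribed non-leaves having `4`, `4` and `c`
children exists as soon as Hall's condition holds: with only three non-leaves, a tournament leaves
no room for a cycle of parents. Let `r` have maximum out-degree. If some `f` of out-degree at least
`4` has at most one common in-neighbour with `r`, a suitable third non-leaf exists whenever `r` has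
at most five in-neighbours (`hasKTree_of_card_commonIn_le_one`). Pairs with two common in-neighbours
are treated under stronger degree conditions. Hence without a tree most vertices have out-degree at
most `3`, and the sum of the out-degrees falls short of the number of arcs. The count says nothing
only when `r` has six in-neighbours; this forces a regular tournament of order `13`, treated by hand
in `hasKTree_of_regular`. -/

theorem IsTournament.irrefl {T : Digraph V} (hT : T.IsTournament) (x : V) : ¬ T.Adj x x := hT.1 x

theorem IsTournament.asymm {T : Digraph V} (hT : T.IsTournament) {x y : V} (h : T.Adj x y) :
    ¬ T.Adj y x := by
  intro h'
  have hne : x ≠ y := by rintro rfl; exact hT.1 _ h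
  rcases hT.2 x y hne with h1 | h1
  · exact h1.2 h'
  · exact h1.2 h

theorem IsTournament.ne {T : Digraph V} (hT : T.IsTournament) {x y : V} (h : T.Adj x y) :
    x ≠ y := by
  rintro rfl; exact hT.1 _ h

theorem IsTournament.adj_of_not {T : Digraph V} (hT : T.IsTournament) {x y : V} (hne : x ≠ y)
    (h : ¬ T.Adj x y) : T.Adj y x := by
  rcases hT.2 x y hne with h1 | h1
  · exact absurd h1.1 h
  · exact h1.1

/-- The subtournament of `T` on `S` has a spanning out-tree in which every `v ∈ S` has exactly
`g v` children. The tree is recorded by its root, its parent function and a function that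
increases from parent to child. -/
def HasOutTree [DecidableEq V] (T : Digraph V) (S : Finset V) (g : V → ℕ) : Prop :=
  ∃ (ρ : V) (par : V → V) (rank : V → ℕ), ρ ∈ S ∧
    (∀ v ∈ S, v ≠ ρ → par v ∈ S ∧ T.Adj (par v) v ∧ rank (par v) < rank v) ∧
    ∀ v ∈ S, #{w ∈ S | w ≠ ρ ∧ par w = v} = g v

section

variable [DecidableEq V] {T : Digraph V} {S : Finset V} {g : V → ℕ}

theorem hasOutTree_singleton (v : V) : T.HasOutTree {v} (fun _ => 0) := by
  refine ⟨v, id, fun _ => 0, by simp, ?_, ?_⟩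
  · intro w hw hne; exact absurd (mem_singleton.1 hw) hne
  · intro w _
    rw [card_eq_zero, filter_eq_empty_iff]
    rintro x hx ⟨h1, _⟩
    exact h1 (mem_singleton.1 hx)

/-- A leaf that dominates a set of new vertices can be given this set as its set of children. -/
theorem HasOutTree.attach (h : T.HasOutTree S g) {l : V} (hl : l ∈ S) (hg : g l = 0)
    {C : Finset V} (hC : Disjoint C S) (hadj : ∀ c ∈ C, T.Adj l c) :
    T.HasOutTree (S ∪ C) (fun v => if v = l then #C else if v ∈ S then g v else 0) := by
  obtain ⟨ρ, par, rank, h1, h2, h3⟩ := h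
  have hCS : ∀ c ∈ C, c ∉ S := fun c hc hs => (disjoint_left.1 hC) hc hs
  refine ⟨ρ, fun v => if v ∈ C then l else par v,
    fun v => if v ∈ C then rank l + 1 else rank v, by simp [h1], ?_, ?_⟩
  · intro v hv hne
    have hlC : l ∉ C := fun hc => hCS _ hc hl
    by_cases hvC : v ∈ C
    · simp [hvC, hlC, hl, hadj v hvC]
    · have hvS : v ∈ S := by simpa [hvC] using hv
      obtain ⟨a1, a2, a3⟩ := h2 v hvS hne
      have : par v ∉ C := fun hc => hCS _ hc a1
      simp [hvC, this, a1, a2, a3]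
  · intro v hv
    have hρC : ρ ∉ C := fun hc => hCS _ hc h1
    have hlf : ∀ w ∈ S, w ≠ ρ → par w ≠ l := by
      have := h3 l hl
      rw [hg, card_eq_zero, filter_eq_empty_iff] at this
      intro w hw hne he
      exact this hw ⟨hne, he⟩
    by_cases hvl : v = l
    · subst hvl
      simp only [if_true]
      congr 1
      ext w
      simp only [mem_filter, mem_union]
      constructor
      · rintro ⟨hw, hne, he⟩
        by_contra hwC
        rw [if_neg hwC] at he
        exact hlf w (by tauto) hne he
      · intro hw
        refine ⟨Or.inr hw, fun he => hρC (he ▸ hw), by simp [hw]⟩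
    · simp only [hvl, if_false]
      by_cases hvS : v ∈ S
      · rw [if_pos hvS, ← h3 v hvS]
        congr 1
        ext w
        simp only [mem_filter, mem_union]
        constructor
        · rintro ⟨hw, hne, he⟩
          by_cases hwC : w ∈ C
          · rw [if_pos hwC] at he; exact absurd he.symm hvl
          · rw [if_neg hwC] at he
            exact ⟨by tauto, hne, he⟩
        · rintro ⟨hw, hne, he⟩
          have : w ∉ C := fun hc => hCS _ hc hw
          exact ⟨Or.inl hw, hne, by simp [this, he]⟩
      · rw [if_neg hvS, card_eq_zero, filter_eq_empty_iff]
        rintro w hw ⟨hne, he⟩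
        by_cases hwC : w ∈ C
        · rw [if_pos hwC] at he; exact hvl he.symm
        · rw [if_neg hwC] at he
          have hwS : w ∈ S := by simpa [hwC] using hw
          exact hvS (he ▸ (h2 w hwS hne).1)

/-- A new vertex `q` with an out-neighbour in a tree can be inserted above the root or into an
arc of the tree, together with a set of new leaves. -/
theorem HasOutTree.insert_star (hT : T.IsTournament) (h : T.HasOutTree S g) {q z : V}
    (hq : q ∉ S) (hz : z ∈ S) (hqz : T.Adj q z) {W : Finset V} (hW : Disjoint W S)
    (hadj : ∀ w ∈ W, T.Adj q w) :
    T.HasOutTree (S ∪ insert q W)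
      (fun v => if v = q then #W + 1 else if v ∈ S then g v else 0) := by
  obtain ⟨ρ, par, rank, h1, h2, h3⟩ := h
  have hWS : ∀ c ∈ W, c ∉ S := fun c hc hs => (disjoint_left.1 hW) hc hs
  have hqW : q ∉ W := fun hc => hT.irrefl q (hadj q hc)
  by_cases hqρ : T.Adj q ρ
  · -- `q` becomes the root
    have hρW : ρ ∉ W := fun hc => hWS _ hc h1
    have hρq : ρ ≠ q := fun he => hq (he ▸ h1)
    refine ⟨q, fun v => if v ∈ W ∨ v = ρ then q else par v,
      fun v => if v = q then 0 else if v ∈ W then 1 else rank v + 1, by simp, ?_, ?_⟩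
    · intro v hv hne
      by_cases hvW : v ∈ W
      · simp [hvW, hadj v hvW, hne]
      · have hvS : v ∈ S := by simpa [hvW, hne] using hv
        by_cases hvρ : v = ρ
        · subst hvρ; simp [hvW, hne, hqρ]
        · obtain ⟨a1, a2, a3⟩ := h2 v hvS hvρ
          have b1 : par v ∉ W := fun hc => hWS _ hc a1
          have b2 : par v ≠ q := fun hc => hq (hc ▸ a1)
          simp [hvW, hvρ, hne, b1, b2, a1, a2, a3]
    · intro v hv
      by_cases hvq : v = q
      · subst hvq
        simp only [if_true]
        rw [← card_insert_of_notMem hρW]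
        congr 1
        ext w
        simp only [mem_filter, mem_union, mem_insert]
        constructor
        · rintro ⟨hw, hne, he⟩
          by_contra hc
          have hc' : ¬ (w ∈ W ∨ w = ρ) := by tauto
          rw [if_neg hc'] at he
          have hwS : w ∈ S := by tauto
          exact hq (he ▸ (h2 w hwS (by tauto)).1)
        · rintro (rfl | hw)
          · exact ⟨Or.inl h1, hρq, by simp⟩
          · exact ⟨Or.inr (Or.inr hw), fun he => hqW (he ▸ hw), by simp [hw]⟩
      · simp only [hvq, if_false]
        by_cases hvS : v ∈ S
        · rw [if_pos hvS, ← h3 v hvS]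
          congr 1
          ext w
          simp only [mem_filter, mem_union, mem_insert]
          constructor
          · rintro ⟨hw, hne, he⟩
            by_cases hc : w ∈ W ∨ w = ρ
            · rw [if_pos hc] at he; exact absurd he.symm hvq
            · rw [if_neg hc] at he
              exact ⟨by tauto, by tauto, he⟩
          · rintro ⟨hw, hne, he⟩
            have : ¬ (w ∈ W ∨ w = ρ) := by
              rintro (hc | hc)
              · exact hWS _ hc hw
              · exact hne hc
            exact ⟨Or.inl hw, fun hc => hq (hc ▸ hw), by simp [this, he]⟩
        · rw [if_neg hvS, card_eq_zero, filter_eq_empty_iff]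
          rintro w hw ⟨hne, he⟩
          by_cases hc : w ∈ W ∨ w = ρ
          · rw [if_pos hc] at he; exact hvq he.symm
          · rw [if_neg hc] at he
            have hwS : w ∈ S := by
              simp only [mem_union, mem_insert] at hw; tauto
            exact hvS (he ▸ (h2 w hwS (by tauto)).1)
  · -- `q` subdivides the arc from `par y` to `y`
    have : DecidablePred (T.Adj q) := Classical.decPred _
    -- The parent of an out-neighbour `y` of least rank is not an out-neighbour of `q`, so it
    -- dominates `q`, and the arc into `y` can be rerouted through `q`.
    obtain ⟨y, hy, hmin⟩ := exists_min_image {v ∈ S | T.Adj q v} rank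
      ⟨z, by simp [hz, hqz]⟩
    rw [mem_filter] at hy
    obtain ⟨hyS, hqy⟩ := hy
    have hyρ : y ≠ ρ := by rintro rfl; exact hqρ hqy
    obtain ⟨a1, a2, a3⟩ := h2 y hyS hyρ
    have hpq : par y ≠ q := fun hc => hq (hc ▸ a1)
    have hyq : y ≠ q := fun hc => hq (hc ▸ hyS)
    have hpy : T.Adj (par y) q := by
      apply hT.adj_of_not hpq.symm
      intro hc
      have := hmin (par y) (by simp [a1, hc])
      omega
    have hyW : y ∉ W := fun hc => hWS _ hc hyS
    have hpW : par y ∉ W := fun hc => hWS _ hc a1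
    have hρW : ρ ∉ W := fun hc => hWS _ hc h1
    have hρq : ρ ≠ q := fun he => hq (he ▸ h1)
    -- Old ranks are doubled so that the rank of `q` fits strictly between those of `par y` and `y`.
    refine ⟨ρ, fun v => if v = q then par y else if v ∈ W ∨ v = y then q else par v,
      fun v => if v = q then 2 * rank (par y) + 1 else if v ∈ W then 2 * rank (par y) + 2
        else 2 * rank v, by simp [h1], ?_, ?_⟩
    · intro v hv hne
      by_cases hvq : v = q
      · subst hvq
        simp [a1, hpy, hpW, hpq]
      by_cases hvW : v ∈ W
      · simp [hvW, hadj v hvW, hvq]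
      have hvS : v ∈ S := by simpa [hvW, hvq] using hv
      by_cases hvy : v = y
      · subst hvy
        simp [hvW, hvq, hqy]; omega
      · obtain ⟨b1, b2, b3⟩ := h2 v hvS hne
        have c1 : par v ∉ W := fun hc => hWS _ hc b1
        have c2 : par v ≠ q := fun hc => hq (hc ▸ b1)
        simp [hvW, hvy, hvq, c1, c2, b1, b2, b3]
    · intro v hv
      by_cases hvq : v = q
      · subst hvq
        simp only [if_true]
        rw [← card_insert_of_notMem hyW]
        congr 1
        ext w
        simp only [mem_filter, mem_union, mem_insert]
        constructor
        · rintro ⟨hw, hne, he⟩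
          by_contra hc
          have hc' : ¬ (w ∈ W ∨ w = y) := by tauto
          rw [if_neg hc'] at he
          by_cases hwv : w = v
          · rw [if_pos hwv] at he; exact hpq he
          rw [if_neg hwv] at he
          have hwS : w ∈ S := by tauto
          exact hq (he ▸ (h2 w hwS hne).1)
        · rintro (rfl | hw)
          · exact ⟨Or.inl hyS, hyρ, by simp [hyq]⟩
          · refine ⟨Or.inr (Or.inr hw), fun he => hρW (he ▸ hw), ?_⟩
            have hwv : w ≠ v := fun he => hqW (he ▸ hw)
            rw [if_neg hwv, if_pos (Or.inl hw)]
      · simp only [hvq, if_false]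
        by_cases hvS : v ∈ S
        · rw [if_pos hvS, ← h3 v hvS]
          symm
          -- Among the children of `par y`, the vertex `q` replaces `y`, so no old number of
          -- children changes.
          apply card_bij' (fun w _ => if w = y then q else w) (fun w _ => if w = q then y else w)
          · intro w hw
            simp only [mem_filter] at hw
            obtain ⟨hwS, hne, he⟩ := hw
            by_cases hwy : w = y
            · subst hwy
              simp [he, hρq.symm]
            · have e1 : w ∉ W := fun hc => hWS _ hc hwS
              have e2 : w ≠ q := fun hc => hq (hc ▸ hwS)
              simp [hwy, hwS, hne, e1, e2, he]
          · intro w hw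
            simp only [mem_filter, mem_union, mem_insert] at hw
            obtain ⟨hwS, hne, he⟩ := hw
            by_cases hwq : w = q
            · rw [if_pos hwq] at he
              simp [hwq, hyS, hyρ, he]
            · rw [if_neg hwq] at he
              by_cases hc : w ∈ W ∨ w = y
              · rw [if_pos hc] at he; exact absurd he.symm hvq
              · rw [if_neg hc] at he
                have : w ∈ S := by tauto
                simp [hwq, this, hne, he]
          · intro w hw
            simp only [mem_filter] at hw
            have e2 : w ≠ q := fun hc => hq (hc ▸ hw.1)
            by_cases hwy : w = y <;> simp [hwy, e2]
          · intro w hw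
            simp only [mem_filter, mem_union, mem_insert] at hw
            obtain ⟨hwS, hne, he⟩ := hw
            by_cases hwq : w = q
            · simp [hwq]
            · rw [if_neg hwq] at he
              have : w ≠ y := by
                rintro rfl
                rw [if_pos (Or.inr rfl)] at he; exact hvq he.symm
              simp [hwq, this]
        · rw [if_neg hvS, card_eq_zero, filter_eq_empty_iff]
          rintro w hw ⟨hne, he⟩
          by_cases hwq : w = q
          · rw [if_pos hwq] at he; exact hvS (he ▸ a1)
          rw [if_neg hwq] at he
          by_cases hc : w ∈ W ∨ w = y
          · rw [if_pos hc] at he; exact hvq he.symm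
          · rw [if_neg hc] at he
            have hwS : w ∈ S := by
              simp only [mem_union, mem_insert] at hw; tauto
            exact hvS (he ▸ (h2 w hwS hne).1)

end

end Digraph

/-! ### From parent functions to `k`-ary spanning trees -/

namespace Digraph

variable {V : Type*}

/-- `T[S]` has a spanning out-tree in which all vertices except possibly one have `0` or `k`
children, and the exceptional one has at most `k` children. -/
def HasKTree [DecidableEq V] (k : ℕ) (T : Digraph V) (S : Finset V) : Prop :=
  ∃ g : V → ℕ, T.HasOutTree S g ∧ ∃ d, ∀ v ∈ S, g v ≤ k ∧ (v ≠ d → g v = 0 ∨ g v = k)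

/-- `T[S]` has a spanning out-tree in which all vertices have `0` or `k` children. -/
def HasFullTree [DecidableEq V] (k : ℕ) (T : Digraph V) (S : Finset V) : Prop :=
  ∃ g : V → ℕ, T.HasOutTree S g ∧ ∀ v ∈ S, g v = 0 ∨ g v = k

theorem HasFullTree.hasKTree [DecidableEq V] {k : ℕ} {T : Digraph V} {S : Finset V}
    (h : HasFullTree k T S) : HasKTree k T S := by
  obtain ⟨g, hg, h1⟩ := h
  obtain ⟨ρ, -⟩ := id hg
  refine ⟨g, hg, ρ, fun v hv => ⟨?_, fun _ => h1 v hv⟩⟩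
  rcases h1 v hv with h | h <;> omega

theorem HasOutTree.of_subtype [DecidableEq V] {T : Digraph V} {S : Finset V} {g : S → ℕ}
    (h : HasOutTree (V := S) ⟨fun a b => T.Adj a b⟩ univ g) :
    T.HasOutTree S (fun v => if h : v ∈ S then g ⟨v, h⟩ else 0) := by
  obtain ⟨ρ, par, rank, -, h2, h3⟩ := h
  refine ⟨ρ, fun v => if h : v ∈ S then par ⟨v, h⟩ else v,
    fun v => if h : v ∈ S then rank ⟨v, h⟩ else 0, ρ.2, ?_, ?_⟩
  · intro v hv hne
    obtain ⟨-, a2, a3⟩ := h2 ⟨v, hv⟩ (mem_univ _) (fun he => hne (congrArg Subtype.val he))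
    simp only [hv, dif_pos, coe_mem]
    exact ⟨trivial, a2, a3⟩
  · intro v hv
    beta_reduce
    rw [dif_pos hv, ← h3 ⟨v, hv⟩ (mem_univ _), ← card_map (Function.Embedding.subtype _)]
    congr 1
    ext w
    simp only [mem_filter, mem_map, mem_univ, true_and, Function.Embedding.subtype_apply]
    constructor
    · rintro ⟨hw, hne, he⟩
      rw [dif_pos hw] at he
      exact ⟨⟨w, hw⟩, ⟨fun hc => hne (congrArg Subtype.val hc), Subtype.ext he⟩, rfl⟩
    · rintro ⟨x, ⟨hne, he⟩, rfl⟩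
      refine ⟨x.2, fun hc => hne (Subtype.ext hc), ?_⟩
      rw [dif_pos x.2]
      exact congrArg Subtype.val he

theorem IsTournament.subtype {T : Digraph V} (hT : T.IsTournament) (S : Finset V) :
    IsTournament (V := S) ⟨fun a b => T.Adj a b⟩ :=
  ⟨fun x => hT.1 x, fun x y hne => hT.2 x y (fun h => hne (Subtype.ext h))⟩

/-- Allows the base orders, proved for a whole vertex type, to be used for subsets in the induction
on the order. -/
theorem HasKTree.of_subtype [DecidableEq V] {k : ℕ} {T : Digraph V} {S : Finset V}
    (h : HasKTree (V := S) k ⟨fun a b => T.Adj a b⟩ univ) : HasKTree k T S := by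
  obtain ⟨g, hg, d, hd⟩ := h
  refine ⟨_, hg.of_subtype, d, fun v hv => ?_⟩
  simp only [hv, dif_pos]
  exact ⟨(hd ⟨v, hv⟩ (mem_univ _)).1, fun hne => (hd ⟨v, hv⟩ (mem_univ _)).2
    fun h => hne (congrArg Subtype.val h)⟩

section ParentDigraph

variable {ρ : V} {par : V → V} {rank : V → ℕ}

/-- The digraph whose arcs lead from the parent to the child. -/
def ofParent (ρ : V) (par : V → V) : Digraph V := ⟨fun x y => y ≠ ρ ∧ par y = x⟩

/-- Passing to parents lowers the rank and can only stop at `ρ`. The rank bound on the path is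
carried along to see that appending `v` creates no repetition. -/
theorem exists_isDiPath_ofParent (hr : ∀ v, v ≠ ρ → rank (par v) < rank v) (v : V) :
    ∃ p, (ofParent ρ par).IsDiPath ρ v p ∧ ∀ u ∈ p, rank u ≤ rank v := by
  induction hn : rank v using Nat.strong_induction_on generalizing v with
  | _ n ih =>
  by_cases hv : v = ρ
  · subst hv
    exact ⟨[v], ⟨rfl, rfl, by simp, by simp⟩, by simp [hn]⟩
  · subst hn
    obtain ⟨p, ⟨p1, p2, p3, p4⟩, hp⟩ := ih _ (hr v hv) (par v) rfl
    have hlt := hr v hv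
    refine ⟨p ++ [v], ⟨?_, by simp, ?_, ?_⟩, ?_⟩
    · rw [List.head?_append, p1]; rfl
    · rw [List.isChain_append]
      refine ⟨p3, by simp, ?_⟩
      intro x hx y hy
      rw [p2] at hx
      simp only [Option.mem_def, Option.some.injEq, List.head?_cons] at hx hy
      subst hx; subst hy
      exact ⟨hv, rfl⟩
    · rw [List.nodup_append]
      refine ⟨p4, by simp, ?_⟩
      intro a ha b hb
      rw [List.mem_singleton] at hb
      subst hb
      rintro rfl
      have := hp _ ha
      omega
    · intro u hu
      rcases List.mem_append.1 hu with hu | hu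
      · have := hp u hu; omega
      · simp at hu; simp [hu]

/-- The last arc of a path to `v` must start at `par v`, and `ρ` has no incoming arc; so a path is
determined backwards from its end. -/
theorem isDiPath_ofParent_unique (p : List V) :
    ∀ (v : V) (p' : List V), (ofParent ρ par).IsDiPath ρ v p →
      (ofParent ρ par).IsDiPath ρ v p' → p = p' := by
  have key : ∀ (p : List V) (a v : V), (p ++ [a]).head? = some ρ →
      (p ++ [a]).getLast? = some v → (p ++ [a]).IsChain (ofParent ρ par).Adj →
      a = v ∧ ((v = ρ ∧ p = []) ∨ (v ≠ ρ ∧ p.head? = some ρ ∧ p.getLast? = some (par v) ∧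
        p.IsChain (ofParent ρ par).Adj)) := by
    intro p a v h1 h2 h3
    have hav : a = v := by simpa using h2
    subst hav
    refine ⟨rfl, ?_⟩
    rcases List.eq_nil_or_concat p with rfl | ⟨q, b, rfl⟩
    · left
      simpa using h1
    · right
      rw [List.concat_eq_append] at h1 h2 h3 ⊢
      rw [List.isChain_append] at h3
      obtain ⟨h3, -, h4⟩ := h3
      have := h4 b (by simp) a (by simp)
      refine ⟨this.1, ?_, by simp [this.2], h3⟩
      rw [List.head?_append] at h1
      cases h : (q ++ [b]).head? with
      | none => simp at h
      | some c => rw [h] at h1; simpa using h1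
  induction p using List.reverseRecOn with
  | nil => intro v p' h; exact absurd h.1 (by simp)
  | append_singleton p a ih =>
    intro v p' h h'
    rcases List.eq_nil_or_concat p' with rfl | ⟨p', b, rfl⟩
    · exact absurd h'.1 (by simp)
    rw [List.concat_eq_append] at h' ⊢
    obtain ⟨ha, k1⟩ := key p a v h.1 h.2.1 h.2.2.1
    obtain ⟨hb, k2⟩ := key p' b v h'.1 h'.2.1 h'.2.2.1
    subst ha; subst hb
    rcases k1 with ⟨e1, e2⟩ | ⟨e1, e2, e3, e4⟩
    · rcases k2 with ⟨f1, f2⟩ | ⟨f1, f2⟩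
      · rw [e2, f2]
      · exact absurd e1 f1
    · rcases k2 with ⟨f1, f2⟩ | ⟨f1, f2, f3, f4⟩
      · exact absurd f1 e1
      · rw [ih (par b) p' ⟨e2, e3, e4, (List.nodup_append.1 h.2.2.2).1⟩
          ⟨f2, f3, f4, (List.nodup_append.1 h'.2.2.2).1⟩]

/-- Ranks exclude opposite arcs, parents connect everything to `ρ`, and `v ↦ s(par v, v)` matches
the non-root vertices with the edges; a connected graph with one edge fewer than vertices is a tree.
-/
theorem isRootedTree_ofParent [Fintype V] (hr : ∀ v, v ≠ ρ → rank (par v) < rank v) :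
    (ofParent ρ par).IsRootedTree ρ := by
  classical
  have asym : ∀ x y, (ofParent ρ par).Adj x y → ¬ (ofParent ρ par).Adj y x := by
    rintro x y ⟨h1, rfl⟩ ⟨h3, h4⟩
    have := hr _ h1
    have := hr _ h3
    rw [h4] at this
    omega
  have adjI : ∀ x y, (ofParent ρ par).toSimpleGraphInclusive.Adj x y ↔
      (ofParent ρ par).Adj x y ∨ (ofParent ρ par).Adj y x := by
    intro x y
    rw [Digraph.toSimpleGraphInclusive, SimpleGraph.fromRel_adj]
    refine ⟨fun h => h.2, fun h => ⟨?_, h⟩⟩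
    rintro rfl
    rcases h with h | h <;> exact asym _ _ h h
  refine ⟨⟨asym, ?_⟩, fun v _ => ?_⟩
  · rw [SimpleGraph.isTree_iff_connected_and_card]
    constructor
    · have : Nonempty V := ⟨ρ⟩
      have hreach : ∀ v, (ofParent ρ par).toSimpleGraphInclusive.Reachable v ρ := by
        intro v
        induction hn : rank v using Nat.strong_induction_on generalizing v with
        | _ n ih =>
        by_cases hv : v = ρ
        · rw [hv]
        · subst hn
          refine SimpleGraph.Reachable.trans (SimpleGraph.Adj.reachable ?_)
            (ih _ (hr v hv) (par v) rfl)
          rw [adjI]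
          exact Or.inr ⟨hv, rfl⟩
      exact ⟨fun u v => (hreach u).trans (hreach v).symm⟩
    · have hcard : Nat.card {v : V // v ≠ ρ} + 1 = Nat.card V := by
        rw [Nat.card_eq_fintype_card, Nat.card_eq_fintype_card, Fintype.card_subtype_compl]
        simp only [Fintype.card_subtype_eq]
        have : 0 < Fintype.card V := Fintype.card_pos_iff.2 ⟨ρ⟩
        omega
      rw [← hcard]
      congr 1
      symm
      refine Nat.card_eq_of_bijective
        (fun v : {v : V // v ≠ ρ} => (⟨s(par v, v), ?_⟩ :
          (ofParent ρ par).toSimpleGraphInclusive.edgeSet)) ⟨?_, ?_⟩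
      · rw [SimpleGraph.mem_edgeSet, adjI]
        exact Or.inl ⟨v.2, rfl⟩
      · rintro ⟨v, hv⟩ ⟨w, hw⟩ h
        have h' : s(par v, v) = s(par w, w) := congrArg Subtype.val h
        rw [Sym2.eq_iff] at h'
        rcases h' with ⟨_, h⟩ | ⟨h1, h2⟩
        · exact Subtype.ext h
        · have a1 := hr v hv
          have a2 := hr w hw
          rw [h1] at a1
          rw [← h2] at a2
          omega
      · rintro ⟨e, he⟩
        induction e with
        | _ x y =>
        rw [SimpleGraph.mem_edgeSet, adjI] at he
        rcases he with h | h
        · exact ⟨⟨y, h.1⟩, Subtype.ext (by simp [h.2])⟩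
        · exact ⟨⟨x, h.1⟩, Subtype.ext (by simp [h.2, Sym2.eq_swap])⟩
  · obtain ⟨p, hp, -⟩ := exists_isDiPath_ofParent hr v
    exact ⟨p, hp, fun q hq => isDiPath_ofParent_unique q v p hq hp⟩

end ParentDigraph

theorem HasKTree.hasKArySpanningTree [Fintype V] [DecidableEq V] {k : ℕ} {T : Digraph V}
    (h : HasKTree k T univ) : T.HasKArySpanningTree k := by
  obtain ⟨g, ⟨ρ, par, rank, -, h2, h3⟩, d, hd⟩ := h
  have hdeg : ∀ v, (ofParent ρ par).outDeg v = g v := by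
    intro v
    rw [← h3 v (mem_univ v), outDeg, ← Set.ncard_coe_finset]
    congr 1
    ext w
    simp [ofParent]
  refine ⟨ofParent ρ par, ?_, ⟨ρ, isRootedTree_ofParent (rank := rank)
    fun v hv => (h2 v (mem_univ v) hv).2.2⟩, ?_, ?_⟩
  · rintro x y ⟨hy, rfl⟩
    exact (h2 y (mem_univ y) hy).2.1
  · intro v _
    rw [hdeg]
    have := (hd v (mem_univ v)).1
    omega
  · intro v hv w hw
    rw [Set.mem_ofPred_eq, hdeg] at hv hw
    have key : ∀ u, g u ≠ 0 ∧ g u ≠ k → u = d := by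
      intro u hu
      by_contra hne
      rcases (hd u (mem_univ u)).2 hne with h | h
      · exact hu.1 h
      · exact hu.2 h
    rw [key v hv, key w hw]

end Digraph

/-! ### Lower bounds -/

namespace Digraph

section LowerBound

variable {V : Type*}

theorem IsDiPath.exists_adj {R : Digraph V} {x y : V} {p : List V} (h : R.IsDiPath x y p)
    (hne : x ≠ y) : ∃ u, R.Adj u y := by
  obtain ⟨h1, h2, h3, -⟩ := h
  rcases List.eq_nil_or_concat p with rfl | ⟨q, b, rfl⟩
  · simp at h1
  rw [List.concat_eq_append] at h1 h2 h3
  rcases List.eq_nil_or_concat q with rfl | ⟨q, a, rfl⟩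
  · simp at h1 h2; exact absurd (h1.symm.trans h2) hne
  rw [List.concat_eq_append, List.isChain_append] at h3
  obtain rfl : b = y := by simpa using h2
  exact ⟨a, h3.2.2 a (by simp) b (by simp)⟩

theorem adj_outDeg_ne_zero [Finite V] {R : Digraph V} {u v : V} (h : R.Adj u v) :
    R.outDeg u ≠ 0 :=
  Set.ncard_ne_zero_of_mem (show v ∈ {w | R.Adj u w} from h)

theorem IsDiPath.outDeg_ne_zero [Finite V] {R : Digraph V} {x y : V} {p : List V}
    (h : R.IsDiPath x y p) (hne : x ≠ y) : R.outDeg x ≠ 0 := by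
  obtain ⟨h1, h2, h3, -⟩ := h
  match p, h1, h2, h3 with
  | [a], h1, h2, _ => simp at h1 h2; exact absurd (h1.symm.trans h2) hne
  | a :: b :: q, h1, _, h3 =>
    obtain rfl : a = x := by simpa using h1
    rw [List.isChain_cons_cons] at h3
    exact adj_outDeg_ne_zero h3.1

/-- Without opposite arcs, arcs correspond to edges of the underlying tree. -/
theorem IsDirectedTree.sum_outDeg [Fintype V] {R : Digraph V} (h : R.IsDirectedTree) :
    ∑ v, R.outDeg v + 1 = Fintype.card V := by
  classical
  have hadj : ∀ x y, R.toSimpleGraphInclusive.Adj x y ↔ R.Adj x y ∨ R.Adj y x := by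
    intro x y
    rw [Digraph.toSimpleGraphInclusive, SimpleGraph.fromRel_adj]
    refine ⟨fun h => h.2, fun h' => ⟨?_, h'⟩⟩
    rintro rfl
    rcases h' with h' | h' <;> exact h.1 _ _ h' h'
  have h1 := (SimpleGraph.isTree_iff_connected_and_card.1 h.2).2
  rw [← Nat.card_eq_fintype_card, ← h1]
  congr 1
  have h2 : ∑ v, R.outDeg v = Nat.card {e : V × V // R.Adj e.1 e.2} := by
    rw [Nat.card_congr (Equiv.subtypeProdEquivSigmaSubtype R.Adj), Nat.card_sigma]
    rfl
  rw [h2]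
  refine Nat.card_eq_of_bijective
    (fun e => (⟨s(e.1.1, e.1.2), ?_⟩ : R.toSimpleGraphInclusive.edgeSet)) ⟨?_, ?_⟩
  · rw [SimpleGraph.mem_edgeSet, hadj]; exact Or.inl e.2
  · rintro ⟨⟨a, b⟩, h3⟩ ⟨⟨c, d⟩, h4⟩ h5
    have h6 : s(a, b) = s(c, d) := congrArg Subtype.val h5
    rw [Sym2.eq_iff] at h6
    rcases h6 with ⟨rfl, rfl⟩ | ⟨rfl, rfl⟩
    · rfl
    · exact absurd h4 (h.1 _ _ h3)
  · rintro ⟨e, he⟩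
    induction e with
    | _ x y =>
    rw [SimpleGraph.mem_edgeSet, hadj] at he
    rcases he with h | h
    · exact ⟨⟨(x, y), h⟩, rfl⟩
    · exact ⟨⟨(y, x), h⟩, Subtype.ext Sym2.eq_swap⟩

/-- In a `k`-ary tree there are a set `F` of vertices with `k` children and a further vertex `d`
with `e < k` children, and all other vertices are leaves. -/
theorem IsKAryTree.exists_degrees [Fintype V] {R : Digraph V} {k : ℕ} (hk : 0 < k)
    (h : R.IsKAryTree k) : ∃ (F : Finset V) (d : V) (e : ℕ), e < k ∧ (∀ v ∈ F, R.outDeg v = k) ∧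
      (∀ v ∉ F, v ≠ d → R.outDeg v = 0) ∧ (d ∉ F → R.outDeg d = e) ∧
      k * #F + e + 1 = Fintype.card V := by
  classical
  obtain ⟨⟨r, hr⟩, h2, h3⟩ := h
  have hsum := hr.1.sum_outDeg
  let F : Finset V := {v | R.outDeg v = k}
  have hF : ∀ v, v ∈ F ↔ R.outDeg v = k := fun v => by simp [F]
  by_cases hD : ∃ d, R.outDeg d ≠ 0 ∧ R.outDeg d ≠ k
  · obtain ⟨d, hd⟩ := hD
    have hz : ∀ v ∉ F, v ≠ d → R.outDeg v = 0 := by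
      intro v hv hne
      rw [hF] at hv
      by_contra h0
      exact hne (h3 ⟨h0, hv⟩ hd)
    refine ⟨F, d, R.outDeg d, ?_, fun v hv => (hF v).1 hv, hz, fun _ => rfl, ?_⟩
    · rcases h2 d hd.1 with h | h
      · exact absurd h hd.2
      · exact h
    · have hdF : d ∉ F := fun h => hd.2 ((hF d).1 h)
      have : ∑ v, R.outDeg v = ∑ v ∈ insert d F, R.outDeg v := by
        symm
        apply sum_subset (subset_univ _)
        intro v _ hv
        rw [mem_insert, not_or] at hv
        exact hz v hv.2 hv.1
      rw [this, sum_insert hdF, sum_congr rfl (fun v hv => (hF v).1 hv), sum_const,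
        smul_eq_mul] at hsum
      rw [← hsum]; ring
  · push Not at hD
    have hz : ∀ v ∉ F, R.outDeg v = 0 := by
      intro v hv
      rw [hF] at hv
      by_contra h0
      exact hv (hD v h0)
    refine ⟨F, r, 0, hk, fun v hv => (hF v).1 hv, fun v hv _ => hz v hv, fun h => hz r h, ?_⟩
    have : ∑ v, R.outDeg v = ∑ v ∈ F, R.outDeg v := by
      symm
      apply sum_subset (subset_univ _)
      intro v _ hv
      exact hz v hv
    rw [this, sum_congr rfl (fun v hv => (hF v).1 hv), sum_const, smul_eq_mul] at hsum
    rw [← hsum]; ring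

/-- A tournament of order `9` in which any two vertices have a common in-neighbour has no
spanning `4`-ary tree. -/
theorem not_hasKArySpanningTree_four [Fintype V] {T : Digraph V} (hT : T.IsTournament)
    (hV : Fintype.card V = 9) (h : ∀ a b, ∃ y, T.Adj y a ∧ T.Adj y b) :
    ¬ T.HasKArySpanningTree 4 := by
  classical
  rintro ⟨R, hRT, hR⟩
  obtain ⟨F, d, e, he, h1, h2, h3, h4⟩ := hR.exists_degrees (by norm_num)
  obtain ⟨⟨r, hr⟩, -, -⟩ := hR
  -- `9 = 4 * 2 + 0 + 1` is the only decomposition with remainder below `4`.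
  have hF2 : #F = 2 := by omega
  have he0 : e = 0 := by omega
  obtain ⟨a, b, hab, rfl⟩ := card_eq_two.1 hF2
  have hnl : ∀ v, R.outDeg v ≠ 0 → v = a ∨ v = b := by
    intro v hv
    by_contra hc
    have hvF : v ∉ ({a, b} : Finset V) := by simpa using hc
    by_cases hvd : v = d
    · subst hvd; exact hv ((h3 hvF).trans he0)
    · exact hv (h2 v hvF hvd)
  -- The root and every parent are `a` or `b`. Since `y` dominates both, it is not the root and
  -- cannot have a parent.
  obtain ⟨y, hya, hyb⟩ := h a b
  have hroot : r = a ∨ r = b := by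
    apply hnl
    have : ∃ v, v ≠ r := by
      by_contra hc
      push Not at hc
      exact hab ((hc a).trans (hc b).symm)
    obtain ⟨v, hv⟩ := this
    obtain ⟨p, hp, -⟩ := hr.2 v hv
    exact hp.outDeg_ne_zero hv.symm
  have hyr : y ≠ r := by
    rintro rfl
    rcases hroot with rfl | rfl
    · exact hT.irrefl _ hya
    · exact hT.irrefl _ hyb
  obtain ⟨p, hp, -⟩ := hr.2 y hyr
  obtain ⟨u, hu⟩ := hp.exists_adj hyr.symm
  rcases hnl u (adj_outDeg_ne_zero hu) with rfl | rfl
  · exact hT.asymm hya (hRT hu)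
  · exact hT.asymm hyb (hRT hu)

/-- A tournament of order `12` in which any two vertices have two common in-neighbours has no
spanning `5`-ary tree. -/
theorem not_hasKArySpanningTree_five [Fintype V] {T : Digraph V} (hT : T.IsTournament)
    (hV : Fintype.card V = 12)
    (h : ∀ a b, ∃ y z, y ≠ z ∧ T.Adj y a ∧ T.Adj y b ∧ T.Adj z a ∧ T.Adj z b) :
    ¬ T.HasKArySpanningTree 5 := by
  classical
  rintro ⟨R, hRT, hR⟩
  obtain ⟨F, d, e, he, h1, h2, h3, h4⟩ := hR.exists_degrees (by norm_num)
  obtain ⟨⟨r, hr⟩, -, -⟩ := hR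
  -- `12 = 5 * 2 + 1 + 1`, so besides `a` and `b` there is one non-leaf `d`, with a single child.
  have hF2 : #F = 2 := by omega
  have he1 : e = 1 := by omega
  obtain ⟨a, b, hab, rfl⟩ := card_eq_two.1 hF2
  have hnl : ∀ v, R.outDeg v ≠ 0 → v = a ∨ v = b ∨ v = d := by
    intro v hv
    by_contra hc
    push Not at hc
    exact hv (h2 v (by simp [hc.1, hc.2.1]) hc.2.2)
  -- a common in-neighbour of `a` and `b` is the root or a child of `d`
  have hdom : ∀ y, T.Adj y a → T.Adj y b → y ≠ r → R.Adj d y := by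
    intro y hya hyb hyr
    obtain ⟨p, hp, -⟩ := hr.2 y hyr
    obtain ⟨u, hu⟩ := hp.exists_adj hyr.symm
    rcases hnl u (adj_outDeg_ne_zero hu) with rfl | rfl | rfl
    · exact absurd (hRT hu) (hT.asymm hya)
    · exact absurd (hRT hu) (hT.asymm hyb)
    · exact hu
  have hd1 : d ∉ ({a, b} : Finset V) → ∀ y z, R.Adj d y → R.Adj d z → y = z := by
    intro hd y z hy hz
    have := h3 hd
    rw [he1, outDeg, Set.ncard_eq_one] at this
    obtain ⟨x, hx⟩ := this
    have hy' : y ∈ ({x} : Set V) := hx ▸ hy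
    have hz' : z ∈ ({x} : Set V) := hx ▸ hz
    rw [Set.mem_singleton_iff] at hy' hz'
    rw [hy', hz']
  -- As `d` has one child, `y` is that child and `z` is the root, whence `z = d`. Then `a` and `b`
  -- can only be children of each other, giving opposite arcs.
  have main : ∀ y z, y ≠ z → T.Adj y a → T.Adj y b → T.Adj z a → T.Adj z b → y ≠ r → False := by
    intro y z hyz hya hyb hza hzb hyr
    have hdy := hdom y hya hyb hyr
    have hd : d ∉ ({a, b} : Finset V) := by
      simp only [mem_insert, mem_singleton, not_or]
      constructor
      · rintro rfl; exact hT.asymm hya (hRT hdy)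
      · rintro rfl; exact hT.asymm hyb (hRT hdy)
    have hzr : z = r := by
      by_contra hzr
      exact hyz (hd1 hd y z hdy (hdom z hza hzb hzr))
    subst hzr
    have hza' : z ≠ a := hT.ne hza
    have hzb' : z ≠ b := hT.ne hzb
    obtain ⟨p, hp, -⟩ := hr.2 a hza'.symm
    rcases hnl z (hp.outDeg_ne_zero hza') with h | h | h
    · exact hza' h
    · exact hzb' h
    · subst h
      -- the only child `y` of the root is a leaf
      have hya' : y ≠ a := hT.ne hya
      have hyb' : y ≠ b := hT.ne hyb
      have hpar : ∀ v, v ≠ z → v ≠ y → R.Adj a v ∨ R.Adj b v := by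
        intro v hvz hvy
        obtain ⟨p, hp, -⟩ := hr.2 v hvz
        obtain ⟨u, hu⟩ := hp.exists_adj hvz.symm
        rcases hnl u (adj_outDeg_ne_zero hu) with rfl | rfl | rfl
        · exact Or.inl hu
        · exact Or.inr hu
        · exact absurd (hd1 hd v y hu hdy) hvy
      have e1 : R.Adj b a := by
        rcases hpar a hza'.symm hya'.symm with h | h
        · exact absurd (hRT h) (hT.irrefl _)
        · exact h
      have e2 : R.Adj a b := by
        rcases hpar b hzb'.symm hyb'.symm with h | h
        · exact h
        · exact absurd (hRT h) (hT.irrefl _)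
      exact hT.asymm (hRT e1) (hRT e2)
  obtain ⟨y, z, hyz, hya, hyb, hza, hzb⟩ := h a b
  by_cases hyr : y = r
  · exact main z y hyz.symm hza hzb hya hyb (by rintro rfl; exact hyz hyr)
  · exact main y z hyz hya hyb hza hzb hyr

end LowerBound

/-- The tournament with vertices `0, …, n - 1` obtained from the circulant tournament modulo `p`
with connection set `Q` by repeating the vertices `0, …, n - p - 1`. -/
def repeatedCirculant (p : ℕ) (Q : Finset ℕ) (n : ℕ) : Digraph (Fin n) :=
  ⟨fun i j => (j.val % p + p - i.val % p) % p ∈ Q ∨ (i.val % p = j.val % p ∧ i.val < j.val)⟩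

instance (p : ℕ) (Q : Finset ℕ) (n : ℕ) : DecidableRel (repeatedCirculant p Q n).Adj :=
  fun i j => inferInstanceAs (Decidable
    ((j.val % p + p - i.val % p) % p ∈ Q ∨ (i.val % p = j.val % p ∧ i.val < j.val)))

/-- The connection set consists of the nonzero squares modulo `7`. As `-1` is not a square, exactly
one of two opposite differences belongs to it. Modulo `11` the same holds. -/
theorem isTournament_repeatedCirculant_seven :
    (repeatedCirculant 7 {1, 2, 4} 9).IsTournament := by
  unfold IsTournament Xor
  constructor <;> decide

theorem isTournament_repeatedCirculant_eleven :
    (repeatedCirculant 11 {1, 3, 4, 5, 9} 12).IsTournament := by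
  unfold IsTournament Xor
  constructor <;> decide

end Digraph

theorem ten_le_of_everyTournament_four {N : ℕ} (h : EveryTournamentHasKArySpanningTree 4 N) :
    10 ≤ N := by
  by_contra hN
  refine Digraph.not_hasKArySpanningTree_four Digraph.isTournament_repeatedCirculant_seven
    (by simp) ?_ (h (Fin 9) (by simp; omega) _ Digraph.isTournament_repeatedCirculant_seven)
  decide

theorem thirteen_le_of_everyTournament_five {N : ℕ}
    (h : EveryTournamentHasKArySpanningTree 5 N) : 13 ≤ N := by
  by_contra hN
  refine Digraph.not_hasKArySpanningTree_five Digraph.isTournament_repeatedCirculant_eleven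
    (by simp) ?_ (h (Fin 12) (by simp; omega) _ Digraph.isTournament_repeatedCirculant_eleven)
  decide

/-! ### Stars, transitive lists and large tournaments -/

namespace Digraph

open Classical in
/-- The out-neighbours of `v` in `S`. -/
noncomputable def outIn {V : Type*} (T : Digraph V) (S : Finset V) (v : V) : Finset V :=
  {w ∈ S | T.Adj v w}

section

open Classical

variable {V : Type*} {T : Digraph V} {k : ℕ}

@[simp] theorem mem_outIn {S : Finset V} {v w : V} : w ∈ T.outIn S v ↔ w ∈ S ∧ T.Adj v w := by
  simp [outIn]

theorem outIn_subset (S : Finset V) (v : V) : T.outIn S v ⊆ S := filter_subset _ _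

theorem IsTournament.sum_card_outIn (hT : T.IsTournament) (S : Finset V) :
    2 * ∑ v ∈ S, #(T.outIn S v) = #S * (#S - 1) := by
  have h1 : ∑ v ∈ S, #(T.outIn S v) = ∑ v ∈ S, #{w ∈ S | T.Adj w v} :=
    sum_card_bipartiteAbove_eq_sum_card_bipartiteBelow T.Adj
  have h2 : ∀ v ∈ S, #(T.outIn S v) + #{w ∈ S | T.Adj w v} = #S - 1 := by
    intro v hv
    rw [← card_erase_of_mem hv, outIn, ← card_union_of_disjoint]
    · congr 1
      ext w
      simp only [mem_union, mem_filter, mem_erase]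
      constructor
      · rintro (⟨h, h'⟩ | ⟨h, h'⟩)
        · exact ⟨(hT.ne h').symm, h⟩
        · exact ⟨hT.ne h', h⟩
      · rintro ⟨h, h'⟩
        by_cases hc : T.Adj v w
        · exact Or.inl ⟨h', hc⟩
        · exact Or.inr ⟨h', hT.adj_of_not h.symm hc⟩
    · rw [disjoint_filter]
      intro w _ h h'
      exact hT.asymm h h'
  rw [two_mul]
  nth_rewrite 2 [h1]
  rw [← sum_add_distrib, sum_congr rfl h2, sum_const, smul_eq_mul]

/-- The average out-degree inside `S` is `(#S - 1) / 2`. This averaging supplies nearly all choices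
of vertices below. -/
theorem IsTournament.exists_card_le_outIn (hT : T.IsTournament) {S : Finset V} (hS : S.Nonempty) :
    ∃ v ∈ S, #S ≤ 2 * #(T.outIn S v) + 1 := by
  by_contra hc
  push Not at hc
  have h1 := hT.sum_card_outIn S
  have h2 : ∑ v ∈ S, (2 * #(T.outIn S v) + 2) ≤ ∑ v ∈ S, #S :=
    sum_le_sum fun v hv => by have := hc v hv; omega
  rw [sum_add_distrib, ← mul_sum, h1, sum_const, sum_const, smul_eq_mul, smul_eq_mul] at h2
  have hpos := card_pos.2 hS
  obtain ⟨m, hm⟩ : ∃ m, #S = m + 1 := ⟨#S - 1, by omega⟩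
  rw [hm] at h2
  simp only [Nat.add_sub_cancel] at h2
  nlinarith

/-! ### Adding `k` vertices -/

theorem HasKTree.insert_star (hT : T.IsTournament) {S : Finset V} (h : HasKTree k T S) {q z : V}
    (hq : q ∉ S) (hz : z ∈ S) (hqz : T.Adj q z) {W : Finset V} (hW : Disjoint W S)
    (hadj : ∀ w ∈ W, T.Adj q w) (hk : #W + 1 = k) : HasKTree k T (S ∪ insert q W) := by
  obtain ⟨g, hg, d, hd⟩ := h
  refine ⟨_, hg.insert_star hT hq hz hqz hW hadj, d, fun v hv => ?_⟩
  by_cases hvq : v = q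
  · simp [hvq, hk]
  · by_cases hvS : v ∈ S
    · simpa [hvq, hvS] using hd v hvS
    · simp [hvq, hvS]

/-- Starting from a full tree, `q` is free to be the single exceptional vertex. -/
theorem HasFullTree.insert_deficient (hT : T.IsTournament) {S : Finset V} (h : HasFullTree k T S)
    {q z : V} (hq : q ∉ S) (hz : z ∈ S) (hqz : T.Adj q z) {W : Finset V} (hW : Disjoint W S)
    (hadj : ∀ w ∈ W, T.Adj q w) (hk : #W + 1 ≤ k) : HasKTree k T (S ∪ insert q W) := by
  obtain ⟨g, hg, hd⟩ := h
  refine ⟨_, hg.insert_star hT hq hz hqz hW hadj, q, fun v hv => ?_⟩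
  by_cases hvq : v = q
  · simp [hvq, hk]
  · by_cases hvS : v ∈ S
    · simp only [hvq, hvS, if_true, if_false]
      have := hd v hvS
      refine ⟨by omega, fun _ => this⟩
    · simp [hvq, hvS]

/-- A set with at least `2 * b` elements, `b > 0`, contains a vertex with `b` out-neighbours. -/
theorem IsTournament.exists_star (hT : T.IsTournament) {S : Finset V} {b : ℕ} (hb : 0 < b)
    (hS : 2 * b ≤ #S) : ∃ q ∈ S, ∃ z ∈ S, ∃ W ⊆ S, T.Adj q z ∧ z ∉ W ∧ #W + 1 = b ∧
      ∀ w ∈ W, T.Adj q w := by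
  obtain ⟨q, hq, h⟩ := hT.exists_card_le_outIn (S := S) (card_pos.1 (by omega))
  obtain ⟨X, hX, hXc⟩ := exists_subset_card_eq (show b ≤ #(T.outIn S q) by omega)
  obtain ⟨z, hz⟩ := card_pos.1 (show 0 < #X by omega)
  have hz' := mem_outIn.1 (hX hz)
  refine ⟨q, hq, z, hz'.1, X.erase z, ?_, hz'.2, by simp, ?_, ?_⟩
  · exact (erase_subset _ _).trans (hX.trans (outIn_subset _ _))
  · rw [card_erase_of_mem hz]; omega
  · intro w hw
    exact (mem_outIn.1 (hX (mem_of_mem_erase hw))).2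

theorem card_sdiff_star {S W : Finset V} {q : V} (hq : q ∈ S) (hW : W ⊆ S) (hqW : q ∉ W) :
    #(S \ insert q W) + (#W + 1) = #S := by
  rw [card_sdiff_of_subset (insert_subset hq hW), card_insert_of_notMem hqW]
  have := card_le_card (insert_subset hq hW)
  rw [card_insert_of_notMem hqW] at this
  omega

/-- Some `q` has `k` out-neighbours. Remove `q` and all but one of them; the out-neighbour `z` left
behind guarantees that `q` can be inserted into a tree on the rest. This is the induction step of
the upper bound. -/
theorem hasKTree_of_forall_card_sub (hT : T.IsTournament) (hk : 0 < k) {S : Finset V}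
    (hS : 2 * k ≤ #S) (h : ∀ S' ⊆ S, #S' + k = #S → HasKTree k T S') : HasKTree k T S := by
  obtain ⟨q, hq, z, hz, W, hW, hqz, hzW, hWc, hadj⟩ := hT.exists_star hk hS
  have hqW : q ∉ W := fun hc => hT.irrefl q (hadj q hc)
  have hc := card_sdiff_star hq hW hqW
  have := (h (S \ insert q W) sdiff_subset (by omega)).insert_star hT (q := q) (z := z) (by simp)
    (by simp [hz, hzW, (hT.ne hqz).symm]) hqz (W := W)
    (disjoint_left.2 fun w hw => by simp [hw]) hadj hWc
  rwa [sdiff_union_of_subset (insert_subset hq hW)] at this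

theorem hasKTree_of_forall_hasFullTree (hT : T.IsTournament) {b : ℕ} (hb : 0 < b) (hbk : b ≤ k)
    {S : Finset V} (hS : 2 * b ≤ #S) (h : ∀ S' ⊆ S, #S' + b = #S → HasFullTree k T S') :
    HasKTree k T S := by
  obtain ⟨q, hq, z, hz, W, hW, hqz, hzW, hWc, hadj⟩ := hT.exists_star hb hS
  have hqW : q ∉ W := fun hc => hT.irrefl q (hadj q hc)
  have hc := card_sdiff_star hq hW hqW
  have := (h (S \ insert q W) sdiff_subset (by omega)).insert_deficient hT (q := q) (z := z)
    (by simp) (by simp [hz, hzW, (hT.ne hqz).symm]) hqz (W := W)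
    (disjoint_left.2 fun w hw => by simp [hw]) hadj (by omega)
  rwa [sdiff_union_of_subset (insert_subset hq hW)] at this

/-! ### Full trees in large tournaments -/

/-- `T[R]` has a spanning out-tree in which all vertices have `0` or `k` children, and all
elements of `L` are leaves. -/
def HasFullTreeWithLeaves (k : ℕ) (T : Digraph V) (R L : Finset V) : Prop :=
  L ⊆ R ∧ ∃ g : V → ℕ, T.HasOutTree R g ∧ (∀ v ∈ R, g v = 0 ∨ g v = k) ∧ ∀ v ∈ L, g v = 0

theorem HasFullTreeWithLeaves.hasFullTree {R L : Finset V} (h : HasFullTreeWithLeaves k T R L) :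
    HasFullTree k T R := by
  obtain ⟨-, g, h1, h2, -⟩ := h
  exact ⟨g, h1, h2⟩

theorem HasFullTreeWithLeaves.mono {R L L' : Finset V} (h : HasFullTreeWithLeaves k T R L)
    (hL : L' ⊆ L) : HasFullTreeWithLeaves k T R L' := by
  obtain ⟨h0, g, h1, h2, h3⟩ := h
  exact ⟨hL.trans h0, g, h1, h2, fun v hv => h3 v (hL hv)⟩

theorem HasFullTreeWithLeaves.attach {R L C : Finset V} (h : HasFullTreeWithLeaves k T R L)
    {l : V} (hl : l ∈ L) (hC : Disjoint C R) (hCk : #C = k) (hadj : ∀ c ∈ C, T.Adj l c) :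
    HasFullTreeWithLeaves k T (R ∪ C) (L.erase l ∪ C) := by
  obtain ⟨h0, g, h1, h2, h3⟩ := h
  refine ⟨union_subset_union_left ((erase_subset _ _).trans h0), _,
    h1.attach (h0 hl) (h3 l hl) hC hadj, fun v _ => ?_, fun v hv => ?_⟩
  · by_cases hvl : v = l
    · simp [hvl, hCk]
    · by_cases hvR : v ∈ R
      · simpa [hvl, hvR] using h2 v hvR
      · simp [hvl, hvR]
  · rcases mem_union.1 hv with hv | hv
    · have hv' := mem_erase.1 hv
      simp [hv'.1, h0 hv'.2, h3 v hv'.2]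
    · have h4 : v ∉ R := disjoint_left.1 hC hv
      have h5 : v ≠ l := by rintro rfl; exact h4 (h0 hl)
      simp [h4, h5]

theorem HasFullTreeWithLeaves.insert_star (hT : T.IsTournament) {R L W : Finset V}
    (h : HasFullTreeWithLeaves k T R L) {q z : V} (hq : q ∉ R) (hz : z ∈ R) (hqz : T.Adj q z)
    (hW : Disjoint W R) (hadj : ∀ w ∈ W, T.Adj q w) (hk : #W + 1 = k) :
    HasFullTreeWithLeaves k T (R ∪ insert q W) L := by
  obtain ⟨h0, g, h1, h2, h3⟩ := h
  refine ⟨h0.trans subset_union_left, _, h1.insert_star hT hq hz hqz hW hadj,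
    fun v _ => ?_, fun v hv => ?_⟩
  · by_cases hvq : v = q
    · simp [hvq, hk]
    · by_cases hvR : v ∈ R
      · simpa [hvq, hvR] using h2 v hvR
      · simp [hvq, hvR]
  · have hvq : v ≠ q := by rintro rfl; exact hq (h0 hv)
    simp [hvq, h0 hv, h3 v hv]

/-- A vertex dominating at least half of the others comes first; recursion takes place in its
out-neighbourhood. -/
theorem IsTournament.exists_transitive_list (hT : T.IsTournament) (m : ℕ) :
    ∀ S : Finset V, 2 ^ m ≤ #S →
      ∃ l : List V, l.length = m ∧ l.Pairwise T.Adj ∧ ∀ x ∈ l, x ∈ S := by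
  induction m with
  | zero => intro S _; exact ⟨[], by simp⟩
  | succ m ih =>
    intro S hS
    obtain ⟨v, hv, h⟩ := hT.exists_card_le_outIn (S := S)
      (card_pos.1 (lt_of_lt_of_le (by positivity) hS))
    obtain ⟨l, h1, h2, h3⟩ := ih (T.outIn S v) (by rw [pow_succ] at hS; omega)
    refine ⟨v :: l, by simp [h1], ?_, ?_⟩
    · rw [List.pairwise_cons]
      exact ⟨fun x hx => (mem_outIn.1 (h3 x hx)).2, h2⟩
    · intro x hx
      rcases List.mem_cons.1 hx with rfl | hx
      · exact hv
      · exact (mem_outIn.1 (h3 x hx)).1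

theorem nodup_of_pairwise_adj (hT : T.IsTournament) {l : List V} (h : l.Pairwise T.Adj) :
    l.Nodup := by
  refine List.Pairwise.imp ?_ h
  intro a b hab
  exact hT.ne hab

/-- A leaf takes an initial segment of a transitive list below it, possibly together with other
vertices. -/
theorem HasFullTreeWithLeaves.attach_take (hT : T.IsTournament) {R L : Finset V}
    {z : V} {Z : List V} (h : HasFullTreeWithLeaves k T R L) (hz : z ∈ L)
    (hZ : (z :: Z).Pairwise T.Adj) (hZR : ∀ x ∈ Z, x ∉ R) {j : ℕ} (hj : j ≤ Z.length)
    {C : Finset V} (hC : ∀ x ∈ C, x ∉ R ∧ x ∉ Z ∧ T.Adj z x) (hjk : #C + j = k) :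
    HasFullTreeWithLeaves k T (R ∪ (C ∪ (Z.take j).toFinset)) (C ∪ (Z.take j).toFinset) := by
  rw [List.pairwise_cons] at hZ
  have hdis : Disjoint C (Z.take j).toFinset := by
    rw [disjoint_left]
    intro x hx hx'
    exact (hC x hx).2.1 (List.mem_of_mem_take (List.mem_toFinset.1 hx'))
  refine (h.attach hz (C := C ∪ (Z.take j).toFinset) ?_ ?_ ?_).mono subset_union_right
  · rw [disjoint_left]
    intro x hx
    rcases mem_union.1 hx with hx | hx
    · exact (hC x hx).1
    · exact hZR x (List.mem_of_mem_take (List.mem_toFinset.1 hx))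
  · rw [card_union_of_disjoint hdis, List.toFinset_card_of_nodup
      ((nodup_of_pairwise_adj hT hZ.2).sublist (List.take_sublist _ _)), List.length_take,
      min_eq_left hj, hjk]
  · intro x hx
    rcases mem_union.1 hx with hx | hx
    · exact (hC x hx).2.2
    · exact hZ.1 x (List.mem_of_mem_take (List.mem_toFinset.1 hx))

theorem pairwise_cons_drop {Z : List V} (hZ : Z.Pairwise T.Adj) {j : ℕ} {y : V}
    (hy : y ∈ Z.take j) : (y :: Z.drop j).Pairwise T.Adj := by
  rw [← List.take_append_drop j Z, List.pairwise_append] at hZ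
  rw [List.pairwise_cons]
  exact ⟨fun x hx => hZ.2.2 y hy x hx, hZ.2.1⟩

theorem notMem_of_mem_drop (hT : T.IsTournament) {Z : List V} (hZ : Z.Pairwise T.Adj) {j : ℕ}
    {x : V} (hx : x ∈ Z.drop j) : x ∉ (Z.take j).toFinset := by
  rw [← List.take_append_drop j Z, List.pairwise_append] at hZ
  intro hx'
  exact hT.irrefl x (hZ.2.2 x (List.mem_toFinset.1 hx') x hx)

theorem toFinset_take_union_drop (Z : List V) (j : ℕ) :
    (Z.take j).toFinset ∪ (Z.drop j).toFinset = Z.toFinset := by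
  rw [← List.toFinset_append, List.take_append_drop]

/-- The leaf `z` takes the first `k` elements of the list, and any of these dominates the remainder
and becomes the next `z`. -/
theorem hasFullTree_union_transitive (hT : T.IsTournament) (hk : 0 < k) :
    ∀ (m : ℕ) (R : Finset V) (z : V) (Z : List V), Z.length = k * m →
      HasFullTreeWithLeaves k T R {z} → (z :: Z).Pairwise T.Adj → (∀ x ∈ Z, x ∉ R) →
      HasFullTree k T (R ∪ Z.toFinset) := by
  intro m
  induction m with
  | zero =>
    intro R z Z hm h _ _
    obtain rfl : Z = [] := List.length_eq_zero_iff.1 (by simpa using hm)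
    simpa using h.hasFullTree
  | succ m ih =>
    intro R z Z hm h hZ hZR
    have hlen : k ≤ Z.length := by rw [hm]; exact Nat.le_mul_of_pos_right _ (by omega)
    have h' := h.attach_take hT (mem_singleton_self z) hZ hZR hlen (C := ∅) (by simp) (by simp)
    rw [empty_union] at h'
    rw [List.pairwise_cons] at hZ
    obtain ⟨y, hy⟩ : ∃ y, y ∈ Z.take k :=
      List.exists_mem_of_length_pos (by rw [List.length_take]; omega)
    have := ih (R ∪ (Z.take k).toFinset) y (Z.drop k) (by rw [List.length_drop, hm]; ring_nf; omega)
      (h'.mono (by simpa using hy)) (pairwise_cons_drop hZ.2 hy) (by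
        intro x hx
        rw [mem_union, not_or]
        exact ⟨hZR x (List.mem_of_mem_drop hx), notMem_of_mem_drop hT hZ.2 hx⟩)
    rwa [union_assoc, toFinset_take_union_drop] at this

/-- A long transitive list below a leaf of a tree absorbs a small set of further vertices. -/
theorem hasFullTree_absorb (hT : T.IsTournament) (hk : 2 ≤ k) :
    ∀ (n : ℕ) (R U : Finset V) (z : V) (Z : List V), #U = n → 2 * k * n ≤ Z.length →
      k ∣ Z.length + n → HasFullTreeWithLeaves k T R {z} → (z :: Z).Pairwise T.Adj →
      (∀ x ∈ Z, x ∉ R) → (∀ x ∈ U, x ∉ R ∧ x ∉ Z) → HasFullTree k T (R ∪ Z.toFinset ∪ U) := by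
  intro n
  induction n with
  | zero =>
    intro R U z Z hU _ hdvd h hZ hZR _
    obtain ⟨m, hm⟩ := hdvd
    rw [card_eq_zero.1 hU, union_empty]
    exact hasFullTree_union_transitive hT (by omega) m R z Z (by simpa using hm) h hZ hZR
  | succ n ih =>
    intro R U z Z hU hlen hdvd h hZ hZR hUR
    obtain ⟨u, hu⟩ := card_pos.1 (show 0 < #U by omega)
    have huR := (hUR u hu).1
    have huZ := (hUR u hu).2
    have hlen' : 2 * k * n + 2 * k ≤ Z.length := by rw [← mul_add_one]; exact hlen
    have hUe : #(U.erase u) = n := by rw [card_erase_of_mem hu]; omega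
    have hZ2 := (List.pairwise_cons.1 hZ).2
    -- a leaf above a transitive list takes `u`
    have take_u : ∀ (R' : Finset V) (z' : V) (Z' : List V), 2 * k * n + k ≤ Z'.length →
        k ∣ Z'.length + (n + 1) → HasFullTreeWithLeaves k T R' {z'} →
        (z' :: Z').Pairwise T.Adj → (∀ x ∈ Z', x ∉ R') → (∀ x ∈ U, x ∉ R' ∧ x ∉ Z') →
        T.Adj z' u → HasFullTree k T (R' ∪ Z'.toFinset ∪ U) := by
      intro R' z' Z' hl hd h' hZ' hZR' hUR' hzu
      have hZ2' := (List.pairwise_cons.1 hZ').2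
      have h2 := h'.attach_take hT (mem_singleton_self z') hZ' hZR' (j := k - 1) (by omega)
        (C := {u}) (by simp [hUR' u hu, hzu]) (by simp; omega)
      obtain ⟨y, hy⟩ : ∃ y, y ∈ Z'.take (k - 1) :=
        List.exists_mem_of_length_pos (by rw [List.length_take]; omega)
      have := ih (R' ∪ ({u} ∪ (Z'.take (k - 1)).toFinset)) (U.erase u) y (Z'.drop (k - 1)) hUe
        (by rw [List.length_drop]; omega)
        (by
          rw [List.length_drop]
          have : Z'.length - (k - 1) + n + k = Z'.length + (n + 1) := by omega
          rw [← this] at hd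
          exact (Nat.dvd_add_left (dvd_refl k)).1 hd)
        (h2.mono (by simp [hy])) (pairwise_cons_drop hZ2' hy)
        (by
          intro x hx
          have hxZ := List.mem_of_mem_drop hx
          have hxu : x ≠ u := by rintro rfl; exact (hUR' x hu).2 hxZ
          simp only [mem_union, mem_singleton, not_or]
          exact ⟨hZR' x hxZ, hxu, notMem_of_mem_drop hT hZ2' hx⟩)
        (by
          intro x hx
          rw [mem_erase] at hx
          have hx' := hUR' x hx.2
          simp only [mem_union, mem_singleton, not_or]
          exact ⟨⟨hx'.1, hx.1, fun hc => hx'.2 (List.mem_of_mem_take (List.mem_toFinset.1 hc))⟩,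
            fun hc => hx'.2 (List.mem_of_mem_drop hc)⟩)
      convert this using 1
      rw [← toFinset_take_union_drop Z' (k - 1), ← insert_erase hu]
      ext x
      simp only [mem_union, mem_insert, mem_erase, mem_singleton]
      tauto
    -- Three ways to absorb `u`: as a child of `z`; inserted above an old vertex with `k - 1` leaves
    -- from the list; or, if `u` dominates too little of the list, as a child of one of its first
    -- `k` elements after `z` has taken these. Each consumes at most `2 * k` list elements.
    by_cases hzu : T.Adj z u
    · exact take_u R z Z (by omega) hdvd h hZ hZR hUR hzu
    have hzR : z ∈ R := h.1 (mem_singleton_self z)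
    have huz : T.Adj u z := hT.adj_of_not (by rintro rfl; exact huR hzR) hzu
    by_cases hout : k - 1 ≤ #(T.outIn Z.toFinset u)
    · -- insert `u` with `k - 1` leaves from the list
      obtain ⟨W, hW, hWc⟩ := exists_subset_card_eq hout
      have hWZ : ∀ w ∈ W, w ∈ Z := fun w hw => List.mem_toFinset.1 (mem_outIn.1 (hW hw)).1
      have h2 := h.insert_star hT huR hzR huz (W := W)
        (disjoint_left.2 fun w hw => hZR w (hWZ w hw)) (fun w hw => (mem_outIn.1 (hW hw)).2)
        (by omega)
      have hnd := nodup_of_pairwise_adj hT hZ2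
      have hsub : (Z.filter (· ∉ W)).Sublist Z := List.filter_sublist
      have hcard : (Z.filter (· ∉ W)).length + (k - 1) = Z.length := by
        rw [← List.toFinset_card_of_nodup (hnd.sublist hsub), ← hWc,
          ← List.toFinset_card_of_nodup hnd, ← card_sdiff_add_card_eq_card
            (show W ⊆ Z.toFinset from fun w hw => List.mem_toFinset.2 (hWZ w hw))]
        congr 2
        ext x; simp
      have := ih (R ∪ insert u W) (U.erase u) z (Z.filter (· ∉ W)) hUe (by omega)
        (by
          have e : (Z.filter (· ∉ W)).length + n + k = Z.length + (n + 1) := by omega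
          rw [← e] at hdvd
          exact (Nat.dvd_add_left (dvd_refl k)).1 hdvd) h2
        (hZ.sublist (List.Sublist.cons_cons z hsub))
        (by
          intro x hx
          rw [List.mem_filter] at hx
          have hxu : x ≠ u := by rintro rfl; exact huZ hx.1
          simp only [mem_union, mem_insert, not_or]
          exact ⟨hZR x hx.1, hxu, by simpa using hx.2⟩)
        (by
          intro x hx
          rw [mem_erase] at hx
          have hx' := hUR x hx.2
          simp only [mem_union, mem_insert, not_or, List.mem_filter, not_and]
          exact ⟨⟨hx'.1, hx.1, fun hc => hx'.2 (hWZ x hc)⟩, fun hc => absurd hc hx'.2⟩)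
      convert this using 1
      ext x
      have hxW : x ∈ W → x ∈ Z := hWZ x
      simp only [mem_union, mem_insert, mem_erase, List.mem_toFinset, List.mem_filter,
        decide_not, Bool.not_eq_true', decide_eq_false_iff_not]
      by_cases hxu : x = u
      · subst hxu; simp [hu]
      · simp only [hxu, ne_eq, not_false_eq_true, true_and, false_or]
        tauto
    · -- one of the first `k` elements of the list dominates `u`
      obtain ⟨y, hy, hyu⟩ : ∃ y ∈ Z.take k, T.Adj y u := by
        by_contra hc
        push Not at hc
        apply hout
        have hsub : (Z.take k).toFinset ⊆ T.outIn Z.toFinset u := by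
          intro y hy
          rw [List.mem_toFinset] at hy
          have hyZ := List.mem_of_mem_take hy
          rw [mem_outIn, List.mem_toFinset]
          exact ⟨hyZ, hT.adj_of_not (by rintro rfl; exact huZ hyZ) (hc y hy)⟩
        have h1 := card_le_card hsub
        rw [List.toFinset_card_of_nodup
          ((nodup_of_pairwise_adj hT hZ2).sublist (List.take_sublist _ _)), List.length_take] at h1
        have : k ≤ Z.length := by omega
        omega
      have h2 := h.attach_take hT (mem_singleton_self z) hZ hZR (j := k) (by omega) (C := ∅)
        (by simp) (by simp)
      rw [empty_union] at h2
      have := take_u (R ∪ (Z.take k).toFinset) y (Z.drop k) (by rw [List.length_drop]; omega)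
        (by
          rw [List.length_drop]
          have e : Z.length - k + (n + 1) + k = Z.length + (n + 1) := by omega
          rw [← e] at hdvd
          exact (Nat.dvd_add_left (dvd_refl k)).1 hdvd)
        (h2.mono (by simp [hy])) (pairwise_cons_drop hZ2 hy)
        (by
          intro x hx
          rw [mem_union, not_or]
          exact ⟨hZR x (List.mem_of_mem_drop hx), notMem_of_mem_drop hT hZ2 hx⟩)
        (by
          intro x hx
          have hx' := hUR x hx
          rw [mem_union, not_or]
          exact ⟨⟨hx'.1, fun hc => hx'.2 (List.mem_of_mem_take (List.mem_toFinset.1 hc))⟩,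
            fun hc => hx'.2 (List.mem_of_mem_drop hc)⟩) hyu
      rwa [union_assoc R, toFinset_take_union_drop] at this

/-- A long transitive list below a leaf of a tree with a second leaf absorbs everything else. -/
theorem hasFullTree_of_transitive_list (hT : T.IsTournament) (hk : 2 ≤ k) :
    ∀ (n : ℕ) (R U : Finset V) (z z' : V) (Z : List V), #U = n → 2 * k * (3 * k) ≤ Z.length →
      k ∣ Z.length + n → HasFullTreeWithLeaves k T R {z, z'} → z ≠ z' →
      (z :: Z).Pairwise T.Adj → (∀ x ∈ Z, x ∉ R) → (∀ x ∈ U, x ∉ R ∧ x ∉ Z) →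
      HasFullTree k T (R ∪ Z.toFinset ∪ U) := by
  intro n
  induction n using Nat.strong_induction_on with
  | _ n ih =>
  intro R U z z' Z hU hlen hdvd h hzz hZ hZR hUR
  -- With more than `3 * k` vertices left, either `k` of them are dominated by all of `R` and go
  -- below `z'`, or `2 * k` of them each dominate some vertex of `R` and contain a star to insert.
  -- In both cases `z` and its list are untouched, so the list is still long enough for the last `3
  -- * k` vertices.
  by_cases hn : n ≤ 3 * k
  · exact hasFullTree_absorb hT hk n R U z Z hU
      (le_trans (Nat.mul_le_mul_left _ hn) hlen) hdvd (h.mono (by simp)) hZ hZR hUR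
  push Not at hn
  -- progress with a set `C` of `k` vertices that has been added to the tree
  have progress : ∀ C ⊆ U, #C = k → ∀ z'' : V, z ≠ z'' →
      HasFullTreeWithLeaves k T (R ∪ C) {z, z''} → HasFullTree k T (R ∪ Z.toFinset ∪ U) := by
    intro C hC hCc z'' hzz'' h'
    have hcard : #(U \ C) = n - k := by rw [card_sdiff_of_subset hC, hU, hCc]
    have := ih (n - k) (by omega) (R ∪ C) (U \ C) z z'' Z hcard hlen
      (by
        have e : Z.length + (n - k) + k = Z.length + n := by omega
        rw [← e] at hdvd
        exact (Nat.dvd_add_left (dvd_refl k)).1 hdvd) h' hzz'' hZ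
      (by
        intro x hx
        rw [mem_union, not_or]
        exact ⟨hZR x hx, fun hc => (hUR x (hC hc)).2 hx⟩)
      (by
        intro x hx
        rw [mem_sdiff] at hx
        have := hUR x hx.1
        simp [this, hx.2])
    convert this using 1
    ext x
    have : x ∈ C → x ∈ U := fun h => hC h
    simp only [mem_union, mem_sdiff]
    tauto
  have hzR : z ∈ R := h.1 (by simp)
  by_cases hU3 : k ≤ #{u ∈ U | ∀ v ∈ R, T.Adj v u}
  · obtain ⟨C, hC, hCc⟩ := exists_subset_card_eq hU3
    have hCU : C ⊆ U := hC.trans (filter_subset _ _)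
    obtain ⟨c, hc⟩ := card_pos.1 (show 0 < #C by omega)
    have hz'R : z' ∈ R := h.1 (by simp)
    refine progress C hCU hCc c (by rintro rfl; exact (hUR z (hCU hc)).1 hzR)
      ((h.attach (l := z') (by simp) ?_ hCc ?_).mono ?_)
    · exact disjoint_left.2 fun x hx => (hUR x (hCU hx)).1
    · intro x hx
      exact (mem_filter.1 (hC hx)).2 z' hz'R
    · intro x hx
      rcases mem_insert.1 hx with rfl | hx
      · simp [hzz]
      · rw [mem_singleton] at hx; subst hx; simp [hc]
  · have hrest : 2 * k ≤ #{u ∈ U | ¬ ∀ v ∈ R, T.Adj v u} := by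
      have := card_filter_add_card_filter_not (s := U) (fun u => ∀ v ∈ R, T.Adj v u)
      omega
    obtain ⟨q, hq, -, -, W, hW, -, -, hWc, hadj⟩ := hT.exists_star (by omega) hrest
    rw [mem_filter] at hq
    obtain ⟨hqU, hq2⟩ := hq
    push Not at hq2
    obtain ⟨v, hvR, hv⟩ := hq2
    have hqR := (hUR q hqU).1
    have hWU : W ⊆ U := hW.trans (filter_subset _ _)
    have hqW : q ∉ W := fun hc => hT.irrefl q (hadj q hc)
    refine progress (insert q W) (insert_subset hqU hWU) (by rw [card_insert_of_notMem hqW, hWc])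
      z' hzz (h.insert_star hT hqR hvR (hT.adj_of_not (by rintro rfl; exact hqR hvR) hv) ?_ hadj
        hWc)
    exact disjoint_left.2 fun x hx => (hUR x (hWU hx)).1

/-- Every sufficiently large tournament whose order is `1` modulo `k` has a spanning out-tree in
which all vertices have `0` or `k` children. -/
theorem exists_forall_hasFullTree (hk : 2 ≤ k) : ∃ N : ℕ, ∀ {V : Type} {T : Digraph V},
    T.IsTournament → ∀ S : Finset V, N ≤ #S → #S % k = 1 → HasFullTree k T S := by
  -- The transitive list provides the root, its `k` children (among them the two leaves `z`, `z'`)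
  -- and the list of length `2 * k * (3 * k)` below `z`.
  refine ⟨2 ^ (k + 1 + 2 * k * (3 * k)), ?_⟩
  intro V T hT S hN hmod
  obtain ⟨l, hl, hpw, hlS⟩ := hT.exists_transitive_list _ S hN
  match l, hl, hpw, hlS with
  | [], hl, _, _ => simp at hl; omega
  | y :: l, hl, hpw, hlS =>
    rw [List.pairwise_cons] at hpw
    have hlen : l.length = k + 2 * k * (3 * k) := by simp at hl; omega
    have hyl : y ∉ l := fun hc => hT.irrefl y (hpw.1 y hc)
    have hnd := nodup_of_pairwise_adj hT hpw.2
    have h0 : HasFullTreeWithLeaves k T {y} {y} :=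
      ⟨Subset.refl _, _, hasOutTree_singleton y, fun _ _ => Or.inl rfl, fun _ _ => rfl⟩
    have h1 := h0.attach_take hT (mem_singleton_self y) (List.pairwise_cons.2 hpw)
      (by rintro x hx hc; rw [mem_singleton] at hc; subst hc; exact hyl hx) (j := k) (by omega)
      (C := ∅) (by simp) (by simp)
    rw [empty_union] at h1
    have htk : #(l.take k).toFinset = k := by
      rw [List.toFinset_card_of_nodup (hnd.sublist (List.take_sublist _ _)), List.length_take]
      omega
    obtain ⟨z, hz, z', hz', hzz⟩ := one_lt_card.1 (show 1 < #(l.take k).toFinset by omega)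
    have hsub : insert y l.toFinset ⊆ S := by
      intro x hx
      apply hlS
      simpa using hx
    have hcard : #(S \ insert y l.toFinset) + (l.length + 1) = #S := by
      rw [card_sdiff_of_subset hsub, card_insert_of_notMem (by simpa using hyl),
        List.toFinset_card_of_nodup hnd]
      have := card_le_card hsub
      rw [card_insert_of_notMem (by simpa using hyl), List.toFinset_card_of_nodup hnd] at this
      omega
    have := hasFullTree_of_transitive_list hT hk _ ({y} ∪ (l.take k).toFinset)
      (S \ insert y l.toFinset) z z' (l.drop k) rfl (by rw [List.length_drop]; omega)
      (by
        rw [List.length_drop]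
        have e : l.length - k + #(S \ insert y l.toFinset) = #S - 1 - k := by omega
        rw [e]
        refine Nat.dvd_sub ?_ (dvd_refl k)
        exact (Nat.modEq_iff_dvd' (by omega)).1
          (by rw [Nat.ModEq, hmod]; exact Nat.mod_eq_of_lt (by omega)))
      (h1.mono (by
        intro x hx
        rcases mem_insert.1 hx with rfl | hx
        · exact hz
        · rw [mem_singleton.1 hx]; exact hz'))
      hzz (pairwise_cons_drop hpw.2 (List.mem_toFinset.1 hz))
      (by
        intro x hx
        simp only [mem_union, mem_singleton, not_or]
        exact ⟨fun hc => hyl (hc ▸ List.mem_of_mem_drop hx), notMem_of_mem_drop hT hpw.2 hx⟩)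
      (by
        intro x hx
        simp only [mem_sdiff, mem_insert, List.mem_toFinset, not_or] at hx
        simp only [mem_union, mem_singleton, not_or, List.mem_toFinset]
        exact ⟨⟨hx.2.1, fun hc => hx.2.2 (List.mem_of_mem_take hc)⟩,
          fun hc => hx.2.2 (List.mem_of_mem_drop hc)⟩)
    convert this using 1
    rw [union_assoc {y}, toFinset_take_union_drop, ← insert_eq, union_sdiff_of_subset hsub]

theorem exists_everyTournamentHasKArySpanningTree (hk : 2 ≤ k) :
    ∃ N, EveryTournamentHasKArySpanningTree k N := by
  obtain ⟨N, hN⟩ := exists_forall_hasFullTree hk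
  refine ⟨N + 2 * k + 2, fun V _ hV T hT => HasKTree.hasKArySpanningTree ?_⟩
  have hcard : #(univ : Finset V) = Fintype.card V := card_univ
  -- This will be the number of children of the exceptional vertex: deleting `b` vertices leaves an
  -- order that is `1` modulo `k`.
  set b := (Fintype.card V - 1) % k with hb
  have hbk : b < k := Nat.mod_lt _ (by omega)
  have hmod : ∀ S' : Finset V, #S' + b = Fintype.card V → #S' % k = 1 := by
    intro S' hS'
    have h1 : #S' - 1 + b = Fintype.card V - 1 := by omega
    have h2 : k ∣ #S' - 1 := by
      have : #S' - 1 = Fintype.card V - 1 - b := by omega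
      rw [this]
      exact Nat.dvd_sub_mod _
    obtain ⟨m, hm⟩ := h2
    have : #S' = 1 + k * m := by omega
    rw [this, Nat.add_mul_mod_self_left, Nat.mod_eq_of_lt (by omega)]
  rcases Nat.eq_zero_or_pos b with hb0 | hbpos
  · exact (hN hT univ (by omega) (hmod univ (by omega))).hasKTree
  · exact hasKTree_of_forall_hasFullTree hT hbpos hbk.le (by omega)
      fun S' _ hS' => hN hT S' (by omega) (hmod S' (by omega))

end

end Digraph

/-! ### Trees with three non-leaves from Hall's theorem -/

namespace Digraph

section

open Classical

variable {V : Type*} [Fintype V] {T : Digraph V}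

/-- Three vertices `p i`, one of them the root `p i₀`, span an out-tree in which `p i` has
`m i` children from `D i` and all other vertices are leaves, if Hall's condition holds. -/
theorem hasOutTree_of_hall (hT : T.IsTournament) {p : Fin 3 → V} (hp : Function.Injective p)
    (i₀ : Fin 3) (m : Fin 3 → ℕ) (hm : ∑ i, m i + 1 = Fintype.card V) {D : Fin 3 → Finset V}
    (hD : ∀ i, ∀ x ∈ D i, x ≠ p i₀ ∧ T.Adj (p i) x)
    (hall : ∀ K : Finset (Fin 3), ∑ i ∈ K, m i ≤ #(K.biUnion D)) :
    ∃ g, T.HasOutTree univ g ∧ (∀ i, g (p i) = m i) ∧ ∀ v, (∀ i, v ≠ p i) → g v = 0 := by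
  -- One slot for each child to be chosen. There are as many slots as non-root vertices, so an
  -- injective choice avoiding the root gives every other vertex exactly one parent.
  let ι := Σ i : Fin 3, Fin (m i)
  obtain ⟨f, hf, hfD⟩ := (Finset.all_card_le_biUnion_card_iff_exists_injective
    (fun x : ι => D x.1)).1 (by
      intro s
      have h1 : s.biUnion (fun x : ι => D x.1) = (s.image Sigma.fst).biUnion D := by
        ext x
        simp only [mem_biUnion, mem_image]
        constructor
        · rintro ⟨a, ha, hx⟩
          exact ⟨a.1, ⟨a, ha, rfl⟩, hx⟩
        · rintro ⟨i, ⟨a, ha, rfl⟩, hx⟩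
          exact ⟨a, ha, hx⟩
      rw [h1]
      refine le_trans ?_ (hall _)
      rw [← sum_congr rfl (fun i _ => Fintype.card_fin (m i))]
      have h2 : s ⊆ (s.image Sigma.fst).sigma fun _ => univ := by
        intro x hx
        rw [mem_sigma]
        exact ⟨mem_image_of_mem _ hx, mem_univ _⟩
      refine (card_le_card h2).trans ?_
      rw [card_sigma]
      simp)
  have hfρ : ∀ x, f x ≠ p i₀ := fun x => (hD x.1 _ (hfD x)).1
  have hsurj : ∀ v, v ≠ p i₀ → ∃ x, f x = v := by
    intro v hv
    have hcard : Fintype.card ι + 1 = Fintype.card V := by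
      rw [← hm, Fintype.card_sigma]; simp
    have himg : univ.image f = univ.erase (p i₀) := by
      apply eq_of_subset_of_card_le
      · intro y hy
        obtain ⟨x, -, rfl⟩ := mem_image.1 hy
        simp [hfρ x]
      · rw [card_image_of_injective _ hf, card_erase_of_mem (mem_univ _), card_univ, card_univ]
        omega
    have : v ∈ univ.image f := by rw [himg]; simp [hv]
    obtain ⟨x, -, hx⟩ := mem_image.1 this
    exact ⟨x, hx⟩
  have hne : i₀ + 1 ≠ i₀ := by omega
  have : Nonempty ι := ⟨(hsurj (p (i₀ + 1)) fun h => hne (hp h)).choose⟩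
  choose! s hs using hsurj
  have hsf : ∀ x, s (f x) = x := fun x => hf (hs _ (hfρ x))
  have hadj : ∀ v, v ≠ p i₀ → T.Adj (p (s v).1) v := by
    intro v hv
    have := (hD _ _ (hfD (s v))).2
    rwa [hs v hv] at this
  refine ⟨fun v => #{x : ι | p x.1 = v}, ⟨p i₀, fun v => p (s v).1,
    fun v => if v = p i₀ then 0 else if ∃ i, v = p i then
      (if p (s v).1 = p i₀ then 1 else 2) else 3, mem_univ _, ?_, ?_⟩, ?_, ?_⟩
  · intro v _ hv
    refine ⟨mem_univ _, hadj v hv, ?_⟩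
    -- No cycle of parents arises: if the parent of one non-root `p j` is the other, then the parent
    -- of the latter is the root, since a tournament has no opposite arcs. So depths `0`, `1`, `2`
    -- suffice for the `p i`, and `3` serves all other vertices.
    have key : (∃ i, v = p i) → p (s v).1 ≠ p i₀ → p (s (p (s v).1)).1 = p i₀ := by
      rintro ⟨j, rfl⟩ h0
      set l := (s (p j)).1 with hl
      have hlj : T.Adj (p l) (p j) := hadj _ hv
      have h2 := hadj (p l) h0
      have e1 : l ≠ j := fun h => hT.irrefl _ (h ▸ hlj)
      have e2 : (s (p l)).1 ≠ l := fun h => hT.irrefl (p l) (by rwa [h] at h2)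
      have e3 : (s (p l)).1 ≠ j := fun h => hT.asymm hlj (by rwa [h] at h2)
      have e4 : j ≠ i₀ := fun h => hv (by rw [h])
      have e5 : l ≠ i₀ := fun h => h0 (by rw [h])
      have e6 : (s (p l)).1 = i₀ := by omega
      rw [e6]
    have hex : ∃ i, p (s v).1 = p i := ⟨_, rfl⟩
    beta_reduce
    rw [if_neg hv, if_pos hex]
    split_ifs <;> first | omega | (exfalso; tauto)
  · intro v _
    beta_reduce
    symm
    apply card_bij' (fun x _ => f x) (fun w _ => s w)
    · intro x hx
      simp only [mem_filter, mem_univ, true_and] at hx ⊢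
      exact ⟨hfρ x, by rw [hsf, hx]⟩
    · intro w hw
      simp only [mem_filter, mem_univ, true_and] at hw ⊢
      exact hw.2
    · intro x _; exact hsf x
    · intro w hw
      simp only [mem_filter, mem_univ, true_and] at hw
      exact hs w hw.1
  · intro i
    have : ({x : ι | p x.1 = p i} : Finset ι) = univ.image (fun j : Fin (m i) => ⟨i, j⟩) := by
      ext ⟨l, j⟩
      simp only [mem_filter, mem_univ, true_and, mem_image]
      constructor
      · intro h
        obtain rfl := hp h
        exact ⟨j, rfl⟩
      · rintro ⟨j', hj'⟩
        rw [Sigma.mk.injEq] at hj'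
        rw [hj'.1]
    beta_reduce
    rw [this, card_image_of_injective _ sigma_mk_injective, card_univ, Fintype.card_fin]
  · intro v hv
    rw [card_eq_zero, filter_eq_empty_iff]
    intro x _ h
    exact hv _ h.symm

/-- A criterion for a spanning `4`-ary tree whose non-leaves are `a`, `b`, `q`. -/
theorem hasKTree_four_of_triple (hT : T.IsTournament) {c : ℕ} (hc : c ≤ 4)
    (hn : Fintype.card V = 9 + c) {a b q ρ : V} (hab : a ≠ b) (haq : a ≠ q) (hbq : b ≠ q)
    (hρ : ρ = a ∨ ρ = b ∨ ρ = q) {A B Q : Finset V} (hA : ∀ x ∈ A, x ≠ ρ ∧ T.Adj a x)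
    (hB : ∀ x ∈ B, x ≠ ρ ∧ T.Adj b x) (hQ : ∀ x ∈ Q, x ≠ ρ ∧ T.Adj q x) (h1 : 4 ≤ #A)
    (h2 : 4 ≤ #B) (h3 : c ≤ #Q) (h12 : 8 ≤ #(A ∪ B)) (h13 : 4 + c ≤ #(A ∪ Q))
    (h23 : 4 + c ≤ #(B ∪ Q)) (h123 : 8 + c ≤ #(A ∪ B ∪ Q)) : HasKTree 4 T univ := by
  let p : Fin 3 → V := ![a, b, q]
  have hp : Function.Injective p := by
    intro i j hij
    fin_cases i <;> fin_cases j <;> simp_all [p]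
  obtain ⟨i₀, hi₀⟩ : ∃ i₀, p i₀ = ρ := by
    rcases hρ with h | h | h
    · exact ⟨0, h.symm⟩
    · exact ⟨1, h.symm⟩
    · exact ⟨2, h.symm⟩
  obtain ⟨g, hg, hgp, hg0⟩ := hasOutTree_of_hall hT hp i₀ ![4, 4, c]
    (by rw [Fin.sum_univ_three, hn]; simp; omega) (D := ![A, B, Q])
    (by
      rw [hi₀]
      intro i
      fin_cases i
      · exact hA
      · exact hB
      · exact hQ)
    (by
      intro K
      have hs : ∑ i ∈ K, ![4, 4, c] i = ∑ i, if i ∈ K then ![4, 4, c] i else 0 := by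
        rw [← sum_filter]; simp
      have hA' : 0 ∈ K → A ⊆ K.biUnion ![A, B, Q] := fun h =>
        subset_biUnion_of_mem (u := ![A, B, Q]) h
      have hB' : 1 ∈ K → B ⊆ K.biUnion ![A, B, Q] := fun h =>
        subset_biUnion_of_mem (u := ![A, B, Q]) h
      have hQ' : 2 ∈ K → Q ⊆ K.biUnion ![A, B, Q] := fun h =>
        subset_biUnion_of_mem (u := ![A, B, Q]) h
      rw [hs, Fin.sum_univ_three]
      by_cases k0 : 0 ∈ K <;> by_cases k1 : 1 ∈ K <;> by_cases k2 : 2 ∈ K <;>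
        simp only [k0, k1, k2, if_true, if_false, forall_const] at hA' hB' hQ' ⊢ <;>
        try simp only [Matrix.cons_val]
      · exact le_trans (by omega) (card_le_card (union_subset (union_subset hA' hB') hQ'))
      · exact le_trans (by omega) (card_le_card (union_subset hA' hB'))
      · exact le_trans (by omega) (card_le_card (union_subset hA' hQ'))
      · exact le_trans (by omega) (card_le_card hA')
      · exact le_trans (by omega) (card_le_card (union_subset hB' hQ'))
      · exact le_trans (by omega) (card_le_card hB')
      · exact le_trans (by omega) (card_le_card hQ')
      · omega)
  refine ⟨g, hg, q, fun v _ => ?_⟩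
  have ga : g a = 4 := hgp 0
  have gb : g b = 4 := hgp 1
  have gq : g q = c := hgp 2
  by_cases hva : v = a
  · subst hva; simp [ga]
  by_cases hvb : v = b
  · subst hvb; simp [gb]
  by_cases hvq : v = q
  · subst hvq; simp [gq, hc]
  · have : g v = 0 := hg0 v (by intro i; fin_cases i <;> simp [p, hva, hvb, hvq])
    simp [this]

end

end Digraph

/-! ### Order `9 + c`: the possible positions of the third non-leaf -/

namespace Digraph

section

open Classical

variable {V : Type*} [Fintype V] {T : Digraph V}

/-- The out-neighbours of `v`. -/
noncomputable abbrev outs (T : Digraph V) (v : V) : Finset V := T.outIn univ v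

/-- The common in-neighbours of `f` and `r`. -/
noncomputable def commonIn (T : Digraph V) (f r : V) : Finset V := {x | T.Adj x f ∧ T.Adj x r}

@[simp] theorem mem_commonIn {f r x : V} : x ∈ T.commonIn f r ↔ T.Adj x f ∧ T.Adj x r := by
  simp [commonIn]

theorem commonIn_comm (f r : V) : T.commonIn f r = T.commonIn r f := by
  ext x; simp [and_comm]

/-- Only `a` and the common in-neighbours are missed, as `b` is dominated by `a`. So `a` and `b` can
have eight distinct children exactly when there are at most `c` common in-neighbours, and the third
non-leaf has to cover these. -/
theorem IsTournament.card_outs_union (hT : T.IsTournament) {a b : V} (hab : T.Adj a b) :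
    #(T.outs a ∪ T.outs b) + #(T.commonIn a b) + 1 = Fintype.card V := by
  have ha : a ∉ T.commonIn a b := by simp [hT.irrefl a]
  have hu : T.outs a ∪ T.outs b ∪ insert a (T.commonIn a b) = univ := by
    ext x
    simp only [mem_union, mem_outIn, mem_univ, true_and, mem_insert, mem_commonIn, iff_true]
    by_cases hxa : x = a
    · simp [hxa]
    by_cases hxb : x = b
    · simp [hxb, hab]
    by_cases h1 : T.Adj a x
    · simp [h1]
    by_cases h2 : T.Adj b x
    · simp [h2]
    exact Or.inr (Or.inr ⟨hT.adj_of_not (Ne.symm hxa) h1, hT.adj_of_not (Ne.symm hxb) h2⟩)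
  have hd : Disjoint (T.outs a ∪ T.outs b) (insert a (T.commonIn a b)) := by
    rw [disjoint_left]
    intro x hx hx'
    simp only [mem_union, mem_outIn, mem_univ, true_and, mem_insert, mem_commonIn] at hx hx'
    rcases hx' with rfl | ⟨h1, h2⟩
    · rcases hx with h | h
      · exact hT.irrefl _ h
      · exact hT.asymm h hab
    · rcases hx with h | h
      · exact hT.asymm h h1
      · exact hT.asymm h h2
  rw [← card_univ, ← hu, card_union_of_disjoint hd, card_insert_of_notMem ha]
  omega

theorem card_outs_add_card_le {f : V} {E X : Finset V} (hXE : X ⊆ E)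
    (hX : ∀ x ∈ X, ¬ T.Adj f x) : #(T.outs f) + #X ≤ #(T.outs f ∪ E) := by
  rw [← card_union_of_disjoint]
  · exact card_le_card (union_subset_union_right hXE)
  · rw [disjoint_left]
    intro x hx hx'
    exact hX x hx' (mem_outIn.1 hx).2

theorem adj_or_of_notMem_commonIn (hT : T.IsTournament) {f r x : V} (hf : x ≠ f) (hr : x ≠ r)
    (hx : x ∉ T.commonIn f r) : T.Adj f x ∨ T.Adj r x := by
  by_contra hc
  push Not at hc
  exact hx (mem_commonIn.2 ⟨hT.adj_of_not hf.symm hc.1, hT.adj_of_not hr.symm hc.2⟩)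

variable {c : ℕ}

/-- Non-leaves `a`, `b`, `q` with root `a`. -/
theorem hasKTree_of_root_dominating (hT : T.IsTournament) (hc : c ≤ 4)
    (hn : Fintype.card V = 9 + c)
    {a b q : V} (hab : T.Adj a b) (hqa : q ≠ a) (hqb : q ≠ b) (ha : 4 ≤ #(T.outs a))
    (hb : 4 ≤ #(T.outs b)) {E : Finset V} (hE : ∀ x ∈ E, T.Adj q x) (haE : a ∉ E)
    (hB : T.commonIn a b ⊆ E) (hBc : #(T.commonIn a b) ≤ c) (hEc : c ≤ #E)
    (haE4 : 4 + c ≤ #(T.outs a ∪ E)) (hbE4 : 4 + c ≤ #(T.outs b ∪ E)) : HasKTree 4 T univ := by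
  have hu := hT.card_outs_union hab
  refine hasKTree_four_of_triple hT hc hn (hT.ne hab) hqa.symm hqb.symm (Or.inl rfl)
    (A := T.outs a) (B := T.outs b) (Q := E) ?_ ?_ ?_ ha hb hEc (by omega) haE4 hbE4 ?_
  · intro x hx
    have := (mem_outIn.1 hx).2
    exact ⟨(hT.ne this).symm, this⟩
  · intro x hx
    have := (mem_outIn.1 hx).2
    exact ⟨by rintro rfl; exact hT.asymm hab this, this⟩
  · intro x hx
    exact ⟨by rintro rfl; exact haE hx, hE x hx⟩
  · have : univ.erase a ⊆ T.outs a ∪ T.outs b ∪ E := by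
      intro x hx
      have hxa := (mem_erase.1 hx).1
      by_cases hxB : x ∈ T.commonIn a b
      · exact mem_union_right _ (hB hxB)
      · refine mem_union_left _ ?_
        by_cases hxb : x = b
        · subst hxb; simp [hab]
        simpa using adj_or_of_notMem_commonIn hT hxa hxb hxB
    have h := card_le_card this
    rw [card_erase_of_mem (mem_univ _), card_univ] at h
    omega

/-- Non-leaves `f`, `r`, `q` with root `f` or `r`. -/
theorem hasKTree_of_outside (hT : T.IsTournament) (hc : c ≤ 4) (hn : Fintype.card V = 9 + c)
    {f r q : V} (hfr : f ≠ r) (hqf : q ≠ f) (hqr : q ≠ r) (hf : 4 ≤ #(T.outs f))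
    (hr : 4 ≤ #(T.outs r)) {E : Finset V} (hE : ∀ x ∈ E, T.Adj q x) (hfE : f ∉ E) (hrE : r ∉ E)
    (hB : T.commonIn f r ⊆ E) (hBc : #(T.commonIn f r) ≤ c) (hEc : c ≤ #E)
    (hfE4 : 4 + c ≤ #(T.outs f ∪ E)) (hrE4 : 4 + c ≤ #(T.outs r ∪ E)) : HasKTree 4 T univ := by
  by_cases h : T.Adj f r
  · exact hasKTree_of_root_dominating hT hc hn h hqf hqr hf hr hE hfE hB hBc hEc hfE4 hrE4
  · rw [commonIn_comm] at hB hBc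
    exact hasKTree_of_root_dominating hT hc hn (hT.adj_of_not hfr h) hqr hqf hr hf hE hrE hB hBc
      hEc hrE4 hfE4

/-- Non-leaves `f`, `r`, `w` with a root `w` dominating `f` and `r`. -/
theorem hasKTree_of_root_above (hT : T.IsTournament) (hc : c ≤ 4) (hn : Fintype.card V = 9 + c)
    {f r w : V} (hfr : f ≠ r) (hwf : T.Adj w f) (hwr : T.Adj w r) (hf : 4 ≤ #(T.outs f))
    (hr : 4 ≤ #(T.outs r)) (hB : ∀ x ∈ T.commonIn f r, x ≠ w → T.Adj w x)
    (hBc : #(T.commonIn f r) ≤ c) (hw : c ≤ #(T.outs w))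
    (hfw : 4 + c ≤ #(T.outs f ∪ T.outs w)) (hrw : 4 + c ≤ #(T.outs r ∪ T.outs w)) :
    HasKTree 4 T univ := by
  have hu : #(T.outs f ∪ T.outs r) + #(T.commonIn f r) + 1 = Fintype.card V := by
    by_cases h : T.Adj f r
    · exact hT.card_outs_union h
    · rw [union_comm, commonIn_comm]
      exact hT.card_outs_union (hT.adj_of_not hfr h)
  refine hasKTree_four_of_triple hT hc hn hfr (hT.ne hwf).symm (hT.ne hwr).symm
    (Or.inr (Or.inr rfl)) (A := T.outs f) (B := T.outs r) (Q := T.outs w) ?_ ?_ ?_ hf hr hw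
    (by omega) hfw hrw ?_
  · intro x hx
    have := (mem_outIn.1 hx).2
    exact ⟨by rintro rfl; exact hT.asymm hwf this, this⟩
  · intro x hx
    have := (mem_outIn.1 hx).2
    exact ⟨by rintro rfl; exact hT.asymm hwr this, this⟩
  · intro x hx
    have := (mem_outIn.1 hx).2
    exact ⟨(hT.ne this).symm, this⟩
  · have : univ.erase w ⊆ T.outs f ∪ T.outs r ∪ T.outs w := by
      intro x hx
      have hxw := (mem_erase.1 hx).1
      by_cases hxf : x = f
      · subst hxf; simp [hwf]
      by_cases hxr : x = r
      · subst hxr; simp [hwr]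
      by_cases hxB : x ∈ T.commonIn f r
      · simp [hB x hxB hxw]
      · refine mem_union_left _ ?_
        simpa using adj_or_of_notMem_commonIn hT hxf hxr hxB
    have h := card_le_card this
    rw [card_erase_of_mem (mem_univ _), card_univ] at h
    omega

/-- Non-leaves `f`, `r`, `q` with `r → q → f`; the root is `r` or `q`. -/
theorem hasKTree_of_between (hT : T.IsTournament) (hc : c ≤ 4) (hn : Fintype.card V = 9 + c)
    {f r q : V} (hfr : f ≠ r) (hqf : T.Adj q f) (hrq : T.Adj r q) (hf : 4 ≤ #(T.outs f))
    (hr : 5 ≤ #(T.outs r)) (hB : ∀ x ∈ T.commonIn f r, T.Adj q x)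
    (hBc : #(T.commonIn f r) + 1 ≤ c) (hq : c ≤ #(T.outs q))
    (hfq : 4 + c ≤ #(T.outs f ∪ T.outs q)) (hrq4 : 4 + c ≤ #(T.outs r ∪ (T.outs q).erase f)) :
    HasKTree 4 T univ := by
  by_cases h : T.Adj f r
  · have hu := hT.card_outs_union h
    have hqu : q ∈ T.outs f ∪ T.outs r := by simp [hrq]
    -- Here `f`, `r`, `q` form a cyclic triangle and the root is `q`. Both sets are `T.outs r ∪
    -- T.outs q` with one vertex removed (`f`, respectively `q`), so the same hypothesis serves both
    -- orientations of the pair `f`, `r`.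
    have hcard : #(T.outs r ∪ (T.outs q).erase f) = #((T.outs r).erase q ∪ T.outs q) := by
      have h1 : insert f (T.outs r ∪ (T.outs q).erase f) = T.outs r ∪ T.outs q := by
        rw [← union_insert, insert_erase (by simp [hqf])]
      have h2 : insert q ((T.outs r).erase q ∪ T.outs q) = T.outs r ∪ T.outs q := by
        rw [← insert_union, insert_erase (by simp [hrq])]
      have h3 := congrArg card h1
      have h4 := congrArg card h2
      rw [card_insert_of_notMem (by
        simp only [mem_union, mem_outIn, mem_univ, true_and, mem_erase, ne_eq, not_true_eq_false,
          false_and, or_false]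
        exact fun h' => hT.asymm h h')] at h3
      rw [card_insert_of_notMem (by simp [hT.irrefl q])] at h4
      omega
    refine hasKTree_four_of_triple hT hc hn hfr (hT.ne hqf).symm (hT.ne hrq)
      (Or.inr (Or.inr rfl)) (A := T.outs f) (B := (T.outs r).erase q) (Q := T.outs q) ?_ ?_ ?_ hf
      (by rw [card_erase_of_mem (by simp [hrq])]; omega) hq ?_ hfq (by omega) ?_
    · intro x hx
      have := (mem_outIn.1 hx).2
      exact ⟨by rintro rfl; exact hT.asymm hqf this, this⟩
    · intro x hx
      rw [mem_erase] at hx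
      exact ⟨hx.1, (mem_outIn.1 hx.2).2⟩
    · intro x hx
      have := (mem_outIn.1 hx).2
      exact ⟨(hT.ne this).symm, this⟩
    · have : (T.outs f ∪ T.outs r).erase q ⊆ T.outs f ∪ (T.outs r).erase q := by
        rw [erase_union_distrib]
        exact union_subset_union_left (erase_subset _ _)
      have h1 := card_le_card this
      rw [card_erase_of_mem hqu] at h1
      omega
    · have : univ.erase q ⊆ T.outs f ∪ (T.outs r).erase q ∪ T.outs q := by
        intro x hx
        have hxq := (mem_erase.1 hx).1
        by_cases hxf : x = f
        · subst hxf; simp [hqf]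
        by_cases hxr : x = r
        · subst hxr; simp [h]
        by_cases hxB : x ∈ T.commonIn f r
        · simp [hB x hxB]
        · refine mem_union_left _ ?_
          simpa [hxq] using adj_or_of_notMem_commonIn hT hxf hxr hxB
      have h := card_le_card this
      rw [card_erase_of_mem (mem_univ _), card_univ] at h
      omega
  · have h' := hT.adj_of_not hfr h
    rw [commonIn_comm] at hBc
    have e : T.outs r ∪ (T.outs q).erase f = T.outs r ∪ T.outs q := by
      ext x
      by_cases hx : x = f
      · subst hx; simp [h', hqf]
      · simp [hx]
    rw [e] at hrq4
    refine hasKTree_of_root_dominating hT hc hn h' (hT.ne hrq).symm (hT.ne hqf) (by omega) hf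
      (E := T.outs q) (by simp) ?_ ?_ (by omega) hq hrq4 hfq
    · simp only [mem_outIn, mem_univ, true_and]
      exact fun h2 => hT.asymm h2 hrq
    · intro x hx
      rw [commonIn_comm] at hx
      simpa using hB x hx

end

end Digraph

/-! ### Exactly one common in-neighbour -/

namespace Digraph

section

open Classical

variable {V : Type*} [Fintype V] {T : Digraph V} {c : ℕ}

/-- The in-neighbours of `f` other than `r`. -/
noncomputable def insExcept (T : Digraph V) (f r : V) : Finset V := {y | y ≠ r ∧ T.Adj y f}

@[simp] theorem mem_insExcept {f r x : V} : x ∈ T.insExcept f r ↔ x ≠ r ∧ T.Adj x f := by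
  simp [insExcept]

theorem IsTournament.card_le_outs_add (hT : T.IsTournament) (f r : V) :
    Fintype.card V ≤ #(T.outs f) + #(T.insExcept f r) + 2 := by
  have h : (univ : Finset V) ⊆ T.outs f ∪ T.insExcept f r ∪ {f, r} := by
    intro x _
    simp only [mem_union, mem_outIn, mem_univ, true_and, mem_insExcept, mem_insert, mem_singleton]
    by_cases hf : x = f
    · simp [hf]
    by_cases hr : x = r
    · simp [hr]
    by_cases h : T.Adj f x
    · simp [h]
    · simp [hr, hT.adj_of_not (Ne.symm hf) h]
  have h1 := card_le_card h
  have h2 := card_union_le (T.outs f ∪ T.insExcept f r) {f, r}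
  have h3 := card_union_le (T.outs f) (T.insExcept f r)
  have h4 : #({f, r} : Finset V) ≤ 2 := card_le_two
  rw [card_univ] at h1
  omega

/-- The third non-leaf must be `w` or dominate `w`. Every in-neighbour of `f` other than `r` and `w`
is dominated by `r`, and it either is dominated by `w`, helping `w` as root, or dominates `w` and is
a candidate between `r` and `f`. -/
theorem hasKTree_of_commonIn_eq_singleton (hT : T.IsTournament) (hc1 : 1 ≤ c) (hc : c ≤ 4)
    (hn : Fintype.card V = 9 + c) {f r w : V} (hfr : f ≠ r) (hf : 4 ≤ #(T.outs f))
    (hr : 3 + c ≤ #(T.outs r)) (hr4 : 4 ≤ #(T.outs r)) (hB : T.commonIn f r = {w}) :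
    HasKTree 4 T univ := by
  have hw : w ∈ T.commonIn f r := by simp [hB]
  obtain ⟨hwf, hwr⟩ := mem_commonIn.1 hw
  have hBw : ∀ x ∈ T.commonIn f r, x = w := by simp [hB]
  have hY := hT.card_le_outs_add f r
  have hry : ∀ y ∈ T.insExcept f r, y ≠ w → T.Adj r y := by
    intro y hy hyw
    obtain ⟨hyr, hyf⟩ := mem_insExcept.1 hy
    by_contra h
    exact hyw (hBw y (mem_commonIn.2 ⟨hyf, hT.adj_of_not hyr.symm h⟩))
  have hnf : ∀ {x}, T.Adj x f → ¬ T.Adj f x := fun h h' => hT.asymm h h'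
  have hnr : ∀ {x}, T.Adj x r → ¬ T.Adj r x := fun h h' => hT.asymm h h'
  have hBcard : #(T.commonIn f r) = 1 := by simp [hB]
  set Yw := T.outIn (T.insExcept f r) w with hYw
  set Y' : Finset V := {y ∈ T.insExcept f r | y ≠ w ∧ T.Adj y w} with hY'
  have hYcard : #(T.insExcept f r) ≤ #Yw + #Y' + 1 := by
    have : T.insExcept f r ⊆ insert w (Yw ∪ Y') := by
      intro x hx
      by_cases hxw : x = w
      · simp [hxw]
      · by_cases h : T.Adj w x
        · exact mem_insert_of_mem (mem_union_left _ (mem_outIn.2 ⟨hx, h⟩))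
        · exact mem_insert_of_mem (mem_union_right _ (mem_filter.2
            ⟨hx, hxw, hT.adj_of_not (Ne.symm hxw) h⟩))
    have h1 := card_le_card this
    have h2 := card_insert_le w (Yw ∪ Y')
    have h3 := card_union_le Yw Y'
    omega
  -- a vertex between `r` and `f` that dominates `w`
  have between : 2 ≤ c → ∀ q ∈ Y', c ≤ #(T.outs q) →
      ∀ X ⊆ T.outIn (T.insExcept f r) q, w ∉ X → 2 + c ≤ #(T.outs f) + #X → HasKTree 4 T univ := by
    intro hc2 q hq hqc X hX hwX hfX
    obtain ⟨hqY, hqw, hqw'⟩ := mem_filter.1 hq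
    obtain ⟨hqr, hqf⟩ := mem_insExcept.1 hqY
    refine hasKTree_of_between hT hc hn hfr hqf (hry q hqY hqw) hf (by omega)
      (fun x hx => by rw [hBw x hx]; exact hqw') (by omega) hqc ?_ ?_
    · have hfX' : f ∉ X := fun h => hT.irrefl f (mem_insExcept.1 (mem_outIn.1 (hX h)).1).2
      have h1 := card_outs_add_card_le (T := T) (f := f) (E := T.outs q)
        (X := insert f (insert w X))
        (by
          intro x hx
          simp only [mem_insert] at hx
          rcases hx with rfl | rfl | hx
          · simpa using hqf
          · simpa using hqw'
          · simpa using (mem_outIn.1 (hX hx)).2)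
        (by
          intro x hx
          simp only [mem_insert] at hx
          rcases hx with rfl | rfl | hx
          · exact hT.irrefl _
          · exact hnf hwf
          · exact hnf (mem_insExcept.1 (mem_outIn.1 (hX hx)).1).2)
      rw [card_insert_of_notMem (by simp [hfX', (hT.ne hwf).symm]), card_insert_of_notMem hwX] at h1
      omega
    · have h1 := card_outs_add_card_le (T := T) (f := r) (E := (T.outs q).erase f) (X := {w})
        (by simp [hqw', hT.ne hwf]) (by simp [hnr hwr])
      rw [card_singleton] at h1
      omega
  -- This is Hall's condition for `f` and `w` with root `w`. If it fails, `Y'` has at least four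
  -- elements, and a vertex of large out-degree inside `Y'` lies between `r` and `f`.
  by_cases hA : 3 + c ≤ #(T.outs f) + #Yw
  · by_cases hwc : c ≤ #(T.outs w)
    · refine hasKTree_of_root_above hT hc hn hfr hwf hwr hf hr4
        (fun x hx hxw => absurd (hBw x hx) hxw) ?_ hwc ?_ ?_
      · omega
      · have hfY : f ∉ Yw := by simp [hYw, hT.irrefl f]
        have h1 := card_outs_add_card_le (T := T) (f := f) (E := T.outs w) (X := insert f Yw)
          (by
            intro x hx
            rcases mem_insert.1 hx with rfl | hx
            · simpa using hwf
            · simpa using (mem_outIn.1 hx).2)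
          (by
            intro x hx
            rcases mem_insert.1 hx with rfl | hx
            · exact hT.irrefl _
            · exact hnf (mem_insExcept.1 (mem_outIn.1 hx).1).2)
        rw [card_insert_of_notMem hfY] at h1
        omega
      · have h1 := card_outs_add_card_le (T := T) (f := r) (E := T.outs w) (X := {r})
          (by simp [hwr]) (by simp [hT.irrefl r])
        rw [card_singleton] at h1
        omega
    · have hYw2 : #Yw + 2 ≤ #(T.outs w) := by
        have h1 : insert f (insert r Yw) ⊆ T.outs w := by
          intro x hx
          simp only [mem_insert] at hx
          rcases hx with rfl | rfl | hx
          · simpa using hwf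
          · simpa using hwr
          · simpa using (mem_outIn.1 hx).2
        have h2 := card_le_card h1
        rwa [card_insert_of_notMem (by simp [hYw, hT.irrefl f, hfr]),
          card_insert_of_notMem (by simp [hYw])] at h2
      set P : Finset V := {x | T.Adj x w} with hP
      -- Since `w` has fewer than `c` out-neighbours, it has many in-neighbours; one with at least
      -- four out-neighbours among them is the candidate `q`.
      have hPcard : 9 ≤ #P := by
        have h1 := hT.card_le_outs_add w w
        have h2 : T.insExcept w w ⊆ P := by
          intro x hx
          simpa [hP] using (mem_insExcept.1 hx).2
        have h3 := card_le_card h2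
        have : (univ : Finset V) ⊆ insert w (T.outs w ∪ P) := by
          intro x _
          by_cases hxw : x = w
          · simp [hxw]
          by_cases h : T.Adj w x
          · simp [h]
          · simp [hP, hT.adj_of_not (Ne.symm hxw) h]
        have h4 := card_le_card this
        have h5 := card_insert_le w (T.outs w ∪ P)
        have h6 := card_union_le (T.outs w) P
        rw [card_univ] at h4
        omega
      obtain ⟨q, hqP, hq⟩ := hT.exists_card_le_outIn (S := P) (card_pos.1 (by omega))
      have hqw : T.Adj q w := by simpa [hP] using hqP
      have hqf : q ≠ f := by rintro rfl; exact hT.asymm hqw hwf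
      have hqr : q ≠ r := by rintro rfl; exact hT.asymm hqw hwr
      have hwP : w ∉ T.outIn P q := by simp [hP, hT.irrefl w]
      have hqE : c ≤ #(T.outs q) := by
        refine le_trans ?_ (card_le_card (show T.outIn P q ⊆ T.outs q from fun x hx => by
          simpa using (mem_outIn.1 hx).2))
        omega
      by_cases hqf' : T.Adj q f
      · exact between (by omega) q (by simp [hY', hqf', hqr, hqw, hT.ne hqw]) hqE ∅ (by simp)
          (by simp) (by simp; omega)
      have outside : ∀ X ⊆ T.outIn P q, (∀ x ∈ X, ¬ T.Adj f x) → 3 + c ≤ #(T.outs f) + #X →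
          HasKTree 4 T univ := by
        intro X hX hXf hfX
        have hwX : w ∉ X := fun h => hwP (hX h)
        refine hasKTree_of_outside hT hc hn hfr hqf hqr hf hr4 (E := insert w (T.outIn P q))
          ?_ ?_ ?_ ?_ (by omega) (by rw [card_insert_of_notMem hwP]; omega) ?_ ?_
        · intro x hx
          rcases mem_insert.1 hx with rfl | hx
          · exact hqw
          · exact (mem_outIn.1 hx).2
        · simp [hqf', (hT.ne hwf).symm]
        · have : ¬ T.Adj r w := hnr hwr
          simp [hP, this, (hT.ne hwr).symm]
        · simp [hB]
        · have h1 := card_outs_add_card_le (T := T) (f := f) (E := insert w (T.outIn P q))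
            (X := insert w X) (insert_subset_insert _ hX) (by
              intro x hx
              rcases mem_insert.1 hx with rfl | hx
              · exact hnf hwf
              · exact hXf x hx)
          rw [card_insert_of_notMem hwX] at h1
          omega
        · have h1 := card_outs_add_card_le (T := T) (f := r) (E := insert w (T.outIn P q))
            (X := {w}) (by simp) (by simp [hnr hwr])
          rw [card_singleton] at h1
          omega
      by_cases ht : 3 + c ≤ #(T.outs f)
      · exact outside ∅ (by simp) (by simp) (by simp; omega)
      by_cases hy : ∃ y ∈ Y', T.Adj q y
      · obtain ⟨y, hy, hqy⟩ := hy
        obtain ⟨hyY, hyw, hyw'⟩ := mem_filter.1 hy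
        refine outside {y} (by simp [hP, hyw', hqy])
          (by simp [hnf (mem_insExcept.1 hyY).2]) (by simp; omega)
      -- Now all of `Y'` dominates `q`, so a vertex `y` of `Y'` with an out-neighbour `y'` in `Y'`
      -- has at least the four out-neighbours `f`, `w`, `q`, `y'` and can replace `q`.
      · push Not at hy
        obtain ⟨y, hyY, hy1⟩ := hT.exists_card_le_outIn (S := Y') (card_pos.1 (by omega))
        obtain ⟨y', hy'⟩ := card_pos.1 (show 0 < #(T.outIn Y' y) by omega)
        obtain ⟨hy'Y, hyy'⟩ := mem_outIn.1 hy'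
        have hyq : T.Adj y q := by
          refine hT.adj_of_not ?_ (hy y hyY)
          rintro rfl
          exact hqf' (mem_insExcept.1 (mem_filter.1 hyY).1).2
        obtain ⟨hyY1, -, hyw⟩ := mem_filter.1 hyY
        obtain ⟨hy'Y1, hy'w, -⟩ := mem_filter.1 hy'Y
        refine between (by omega) y hyY ?_ {y'} (by simpa [hyy'] using hy'Y1)
          (by simpa using hy'w.symm)
          (by simp; omega)
        have h1 : {f, w, q, y'} ⊆ T.outs y := by
          intro x hx
          simp only [mem_insert, mem_singleton] at hx
          rcases hx with rfl | rfl | rfl | rfl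
          · simpa using (mem_insExcept.1 hyY1).2
          · simpa using hyw
          · simpa using hyq
          · simpa using hyy'
        have h2 := card_le_card h1
        have hfy' : f ≠ y' := by
          rintro rfl
          exact hT.irrefl _ (mem_insExcept.1 hy'Y1).2
        have hqy' : q ≠ y' := by
          rintro rfl
          exact hqf' (mem_insExcept.1 hy'Y1).2
        rw [card_insert_of_notMem (by simp [(hT.ne hwf).symm, hqf.symm, hfy']),
          card_insert_of_notMem (by simp [(hT.ne hqw).symm, hy'w.symm]),
          card_insert_of_notMem (by simp [hqy']), card_singleton] at h2
        omega
  · obtain ⟨q, hqY, hq⟩ := hT.exists_card_le_outIn (S := Y') (card_pos.1 (by omega))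
    obtain ⟨hqY1, -, hqw⟩ := mem_filter.1 hqY
    have hqf := (mem_insExcept.1 hqY1).2
    have hwX : w ∉ T.outIn Y' q := by simp [hY']
    have hfX : f ∉ T.outIn Y' q := by simp [hY', hT.irrefl f]
    refine between (by omega) q hqY ?_ (T.outIn Y' q) ?_ hwX (by omega)
    · have h1 : insert f (insert w (T.outIn Y' q)) ⊆ T.outs q := by
        intro x hx
        simp only [mem_insert] at hx
        rcases hx with rfl | rfl | hx
        · simpa using hqf
        · simpa using hqw
        · simpa using (mem_outIn.1 hx).2
      have h2 := card_le_card h1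
      rw [card_insert_of_notMem (by
        rw [mem_insert, not_or]; exact ⟨(hT.ne hwf).symm, hfX⟩), card_insert_of_notMem hwX] at h2
      omega
    · intro x hx
      obtain ⟨h1, h2⟩ := mem_outIn.1 hx
      exact mem_outIn.2 ⟨(mem_filter.1 h1).1, h2⟩

end

end Digraph

/-! ### No common in-neighbour, and two common in-neighbours -/

namespace Digraph

section

open Classical

variable {V : Type*} [Fintype V] {T : Digraph V} {c : ℕ}

/-- Otherwise averaging inside the set of these vertices already yields an out-degree above `m`. -/
theorem IsTournament.card_filter_outIn_le {V : Type*} {T : Digraph V} (hT : T.IsTournament)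
    (S : Finset V) (m : ℕ) :
    #{y ∈ S | #(T.outIn S y) ≤ m} ≤ 2 * m + 1 := by
  by_contra h
  set R : Finset V := {y ∈ S | #(T.outIn S y) ≤ m} with hR
  obtain ⟨v, hv, h1⟩ := hT.exists_card_le_outIn (S := R) (card_pos.1 (by omega))
  have h2 : T.outIn R v ⊆ T.outIn S v := by
    intro x hx
    obtain ⟨h1, h2⟩ := mem_outIn.1 hx
    exact mem_outIn.2 ⟨(mem_filter.1 h1).1, h2⟩
  have h3 := card_le_card h2
  have h4 := (mem_filter.1 hv).2
  omega

theorem adj_of_mem_insExcept (hT : T.IsTournament) {f r : V} (hB : T.commonIn f r = ∅) {y : V}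
    (hy : y ∈ T.insExcept f r) : T.Adj r y := by
  obtain ⟨hyr, hyf⟩ := mem_insExcept.1 hy
  by_contra h
  have : y ∈ T.commonIn f r := mem_commonIn.2 ⟨hyf, hT.adj_of_not hyr.symm h⟩
  simp [hB] at this

theorem card_outIn_insExcept_lt {f r q : V} (hT : T.IsTournament) (hq : T.Adj q f) :
    #(T.outIn (T.insExcept f r) q) + 1 ≤ #(T.outs q) := by
  have hf : f ∉ T.outIn (T.insExcept f r) q := by simp [hT.irrefl f]
  rw [← card_insert_of_notMem hf]
  apply card_le_card
  intro x hx
  rcases mem_insert.1 hx with rfl | hx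
  · simpa using hq
  · simpa using (mem_outIn.1 hx).2

theorem le_card_outs_union_outs {f r q : V} (hT : T.IsTournament) (hq : T.Adj q f) :
    #(T.outs f) + 1 + #(T.outIn (T.insExcept f r) q) ≤ #(T.outs f ∪ T.outs q) := by
  have hf : f ∉ T.outIn (T.insExcept f r) q := by simp [hT.irrefl f]
  have h1 := card_outs_add_card_le (T := T) (f := f) (E := T.outs q)
    (X := insert f (T.outIn (T.insExcept f r) q))
    (by
      intro x hx
      rcases mem_insert.1 hx with rfl | hx
      · simpa using hq
      · simpa using (mem_outIn.1 hx).2)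
    (by
      intro x hx
      rcases mem_insert.1 hx with rfl | hx
      · exact hT.irrefl _
      · exact fun h => hT.asymm h (mem_insExcept.1 (mem_outIn.1 hx).1).2)
  rw [card_insert_of_notMem hf] at h1
  omega

/-- Hall's condition for `r` and the third non-leaf is automatic, so only that for `f` matters. An
in-neighbour of `f` with enough out-neighbours works between `r` and `f`; otherwise these
in-neighbours are few and of small out-degree, and an outside vertex dominates several of them. -/
theorem hasKTree_of_commonIn_eq_empty_of_large (hT : T.IsTournament) (hc1 : 1 ≤ c) (hc : c ≤ 4)
    (hn : Fintype.card V = 9 + c) {f r : V} (hfr : f ≠ r) (hf : 4 ≤ #(T.outs f))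
    (hr : 4 + c ≤ #(T.outs r)) (hB : T.commonIn f r = ∅) : HasKTree 4 T univ := by
  have hYc := hT.card_le_outs_add f r
  set Y := T.insExcept f r with hY
  have between : ∀ q ∈ Y, c ≤ #(T.outs q) →
      3 + c ≤ #(T.outs f) + #(T.outIn Y q) → HasKTree 4 T univ := by
    intro q hq hqc h
    have hqf := (mem_insExcept.1 hq).2
    have h1 := le_card_outs_union_outs (r := r) hT hqf
    rw [← hY] at h1
    refine hasKTree_of_between hT hc hn hfr hqf (adj_of_mem_insExcept hT hB hq) hf (by omega)
      (by simp [hB]) (by simp [hB]; omega) hqc (by omega) ?_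
    exact hr.trans (card_le_card subset_union_left)
  have outside : ∀ q, q ≠ f → q ≠ r → ∀ E : Finset V, (∀ x ∈ E, T.Adj q x) → f ∉ E → r ∉ E →
      c ≤ #E → 4 + c ≤ #(T.outs f ∪ E) → HasKTree 4 T univ := by
    intro q hqf hqr E hE hfE hrE hEc hfE4
    exact hasKTree_of_outside hT hc hn hfr hqf hqr hf (by omega) hE hfE hrE (by simp [hB])
      (by simp [hB]) hEc hfE4 (hr.trans (card_le_card subset_union_left))
  by_cases h3 : ∃ q ∈ Y, 3 ≤ #(T.outIn Y q)
  · obtain ⟨q, hq, h⟩ := h3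
    have hlt := card_outIn_insExcept_lt (r := r) hT (mem_insExcept.1 hq).2
    rw [← hY] at hlt
    exact between q hq (by omega) (by omega)
  push Not at h3
  have hY5 : #Y ≤ 5 := by
    rcases Y.eq_empty_or_nonempty with h | h
    · simp [h]
    · obtain ⟨v, hv, h1⟩ := hT.exists_card_le_outIn h
      have := h3 v hv
      omega
  by_cases h1 : ∃ y ∈ Y, c ≤ #(T.outs y) ∧ 1 ≤ #(T.outIn Y y)
  · obtain ⟨y, hy, h, h'⟩ := h1
    exact between y hy h (by omega)
  push Not at h1
  set M : Finset V := univ \ {f, r} with hM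
  have hMc : #M = 7 + c := by
    rw [hM, card_sdiff_of_subset (subset_univ _), card_univ, card_pair hfr]
    omega
  have hfM : f ∉ M := by simp [hM]
  have hrM : r ∉ M := by simp [hM]
  have hne : ∀ x ∈ M, x ≠ f ∧ x ≠ r := by simp [hM]
  by_cases ht : 4 + c ≤ #(T.outs f)
  · obtain ⟨z, hz, h⟩ := hT.exists_card_le_outIn (S := M) (card_pos.1 (by omega))
    have hsub : T.outIn M z ⊆ T.outs z := fun x hx => by simpa using (mem_outIn.1 hx).2
    have hle := card_le_card hsub
    by_cases hzf : T.Adj z f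
    · exact between z (mem_insExcept.2 ⟨(hne z hz).2, hzf⟩) (by omega) (by omega)
    · exact outside z (hne z hz).1 (hne z hz).2 (T.outIn M z) (fun x hx => (mem_outIn.1 hx).2)
        (fun h => hfM (mem_outIn.1 h).1) (fun h => hrM (mem_outIn.1 h).1) (by omega)
        (ht.trans (card_le_card subset_union_left))
  have hH0 : 3 ≤ #{y ∈ Y | 1 ≤ #(T.outIn Y y)} := by
    have h2 := hT.card_filter_outIn_le Y 0
    have h4 := card_filter_add_card_filter_not (s := Y) (fun y => #(T.outIn Y y) ≤ 0)
    have h5 : ({y ∈ Y | ¬ #(T.outIn Y y) ≤ 0} : Finset V) = {y ∈ Y | 1 ≤ #(T.outIn Y y)} := by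
      apply filter_congr
      intro x _
      omega
    rw [h5] at h4
    omega
  obtain ⟨H, hH, hHc⟩ := exists_subset_card_eq hH0
  have hHY : H ⊆ Y := hH.trans (filter_subset _ _)
  have hlow : ∀ y ∈ H, #(T.outIn (M \ Y) y) + 3 ≤ c := by
    intro y hy
    have hyY := hHY hy
    have hy1 := (mem_filter.1 (hH hy)).2
    have h2 : ¬ c ≤ #(T.outs y) := fun h => absurd hy1 (by have := h1 y hyY h; omega)
    have hd : Disjoint (T.outIn (M \ Y) y) (T.outIn Y y) := by
      rw [disjoint_left]
      intro x hx hx'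
      exact (mem_sdiff.1 (mem_outIn.1 hx).1).2 (mem_outIn.1 hx').1
    have hf' : f ∉ T.outIn (M \ Y) y ∪ T.outIn Y y := by simp [hM, hY, hT.irrefl f]
    have h3 : insert f (T.outIn (M \ Y) y ∪ T.outIn Y y) ⊆ T.outs y := by
      intro x hx
      simp only [mem_insert, mem_union] at hx
      rcases hx with rfl | hx | hx
      · simpa using (mem_insExcept.1 hyY).2
      · simpa using (mem_outIn.1 hx).2
      · simpa using (mem_outIn.1 hx).2
    have h4 := card_le_card h3
    rw [card_insert_of_notMem hf', card_union_of_disjoint hd] at h4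
    omega
  -- The three vertices of `H` have fewer than `c` out-neighbours, hence at most `c - 3` each in `M
  -- \ Y`. At least three vertices of `M \ Y` therefore dominate all of `H`; an arc between two of
  -- them supplies a fourth child.
  set G : Finset V := (M \ Y) \ H.biUnion (fun y => T.outIn (M \ Y) y) with hG
  have hGc : 3 ≤ #G := by
    have h2 : #(H.biUnion (fun y => T.outIn (M \ Y) y)) ≤ 3 * (c - 3) := by
      rw [← hHc]
      exact card_biUnion_le_card_mul _ _ _ fun y hy => by have := hlow y hy; omega
    have h3 := le_card_sdiff (H.biUnion (fun y => T.outIn (M \ Y) y)) (M \ Y)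
    have h4 := le_card_sdiff Y M
    rw [← hG] at h3
    obtain ⟨y, hy⟩ := card_pos.1 (show 0 < #H by omega)
    have := hlow y hy
    omega
  have hGadj : ∀ z ∈ G, ∀ y ∈ H, T.Adj z y := by
    intro z hz y hy
    obtain ⟨hz1, hz2⟩ := mem_sdiff.1 hz
    have hzY := (mem_sdiff.1 hz1).2
    refine hT.adj_of_not (by rintro rfl; exact hzY (hHY hy)) fun h => hz2 ?_
    exact mem_biUnion.2 ⟨y, hy, mem_outIn.2 ⟨hz1, h⟩⟩
  obtain ⟨z, hz, hz1⟩ := hT.exists_card_le_outIn (S := G) (card_pos.1 (by omega))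
  obtain ⟨z', hz'⟩ := card_pos.1 (show 0 < #(T.outIn G z) by omega)
  obtain ⟨hz'G, hzz'⟩ := mem_outIn.1 hz'
  have hGM : ∀ x ∈ G, x ∈ M ∧ x ∉ Y := fun x hx => mem_sdiff.1 (mem_sdiff.1 hx).1
  have hz'H : z' ∉ H := fun h => (hGM z' hz'G).2 (hHY h)
  have hfH : f ∉ H := fun h => hT.irrefl f (mem_insExcept.1 (hHY h)).2
  have hrH : r ∉ H := fun h => (mem_insExcept.1 (hHY h)).1 rfl
  have hz'ne := hne z' (hGM z' hz'G).1
  have hzne := hne z (hGM z hz).1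
  refine outside z hzne.1 hzne.2 (insert z' H) ?_ ?_ ?_ ?_ ?_
  · intro x hx
    rcases mem_insert.1 hx with rfl | hx
    · exact hzz'
    · exact hGadj z hz x hx
  · simp [hz'ne.1.symm, hfH]
  · simp [hz'ne.2.symm, hrH]
  · rw [card_insert_of_notMem hz'H]
    omega
  · have h2 := card_outs_add_card_le (T := T) (f := f) (E := insert z' H) (X := H)
      (subset_insert _ _) (fun x hx h => hT.asymm h (mem_insExcept.1 (hHY hx)).2)
    omega

/-- Hall's condition for `r` now lacks one vertex. An arc from a good `y` in `Y` to `Z` supplies it;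
if there is none, `Z` dominates all good vertices of `Y`, and an element of `Z` works with `f` and
`r` exchanged. -/
theorem hasKTree_of_commonIn_eq_empty_of_eq (hT : T.IsTournament) (hc2 : 2 ≤ c) (hc : c ≤ 4)
    (hn : Fintype.card V = 9 + c) {f r : V} (hfr : f ≠ r) (hf : 5 ≤ #(T.outs f))
    (hfr' : #(T.outs f) ≤ #(T.outs r)) (hr : #(T.outs r) = 3 + c) (hB : T.commonIn f r = ∅) :
    HasKTree 4 T univ := by
  have hYc := hT.card_le_outs_add f r
  have hZc := hT.card_le_outs_add r f
  have hB' : T.commonIn r f = ∅ := by rw [commonIn_comm, hB]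
  set Y := T.insExcept f r with hY
  set Z := T.insExcept r f with hZ
  have hYZ : ∀ x ∈ Y, x ∉ Z := by
    intro x hx hx'
    have : x ∈ T.commonIn f r := mem_commonIn.2 ⟨(mem_insExcept.1 hx).2, (mem_insExcept.1 hx').2⟩
    simp [hB] at this
  by_cases h : ∃ y ∈ Y, c ≤ #(T.outIn Y y) + 2 ∧ ∃ z ∈ Z, T.Adj y z
  · obtain ⟨y, hy, hyc, z, hz, hyz⟩ := h
    have hyf := (mem_insExcept.1 hy).2
    have hzr := (mem_insExcept.1 hz).2
    have hzf := (mem_insExcept.1 hz).1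
    have h1 := le_card_outs_union_outs (r := r) hT hyf
    rw [← hY] at h1
    refine hasKTree_of_between hT hc hn hfr hyf (adj_of_mem_insExcept hT hB hy) (by omega)
      (by omega) (by simp [hB]) (by simp [hB]; omega) ?_ (by omega) ?_
    · have hzY : z ∉ T.outIn Y y := fun h => hYZ z (mem_outIn.1 h).1 hz
      have hfX : f ∉ insert z (T.outIn Y y) := by simp [hY, hT.irrefl f, hzf.symm]
      have h2 : insert f (insert z (T.outIn Y y)) ⊆ T.outs y := by
        intro x hx
        simp only [mem_insert] at hx
        rcases hx with rfl | rfl | hx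
        · simpa using hyf
        · simpa using hyz
        · simpa using (mem_outIn.1 hx).2
      have h3 := card_le_card h2
      rw [card_insert_of_notMem hfX, card_insert_of_notMem hzY] at h3
      omega
    · have h2 := card_outs_add_card_le (T := T) (f := r) (E := (T.outs y).erase f) (X := {z})
        (by simp [hyz, hzf]) (by simpa using fun h => hT.asymm h hzr)
      rw [card_singleton] at h2
      omega
  push Not at h
  set Yp : Finset V := {y ∈ Y | c ≤ #(T.outIn Y y) + 2} with hYp
  -- At most `2 * (c - 3) + 1` vertices have at most `c - 3` out-neighbours in `Y`. For `c = 2` the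
  -- truncated difference is `0`, as it should be.
  have hlow : #Y ≤ #Yp + (2 * c - 5) := by
    have h4 := card_filter_add_card_filter_not (s := Y) (fun y => c ≤ #(T.outIn Y y) + 2)
    rw [← hYp] at h4
    by_cases hc3 : 3 ≤ c
    · have h2 := hT.card_filter_outIn_le Y (c - 3)
      have h5 : ({y ∈ Y | ¬ c ≤ #(T.outIn Y y) + 2} : Finset V) =
          {y ∈ Y | #(T.outIn Y y) ≤ c - 3} := by
        apply filter_congr
        intro x _
        omega
      rw [h5] at h4
      omega
    · have h5 : ({y ∈ Y | ¬ c ≤ #(T.outIn Y y) + 2} : Finset V) = ∅ := by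
        rw [filter_eq_empty_iff]
        intro x _
        omega
      rw [h5, card_empty] at h4
      omega
  have hdom : ∀ z ∈ Z, ∀ y ∈ Yp, T.Adj z y := by
    intro z hz y hy
    obtain ⟨hy1, hy2⟩ := mem_filter.1 hy
    exact hT.adj_of_not (by rintro rfl; exact hYZ _ hy1 hz) (h y hy1 hy2 z hz)
  obtain ⟨z, hz, hz1⟩ := hT.exists_card_le_outIn (S := Z) (card_pos.1 (by omega))
  have hzr := (mem_insExcept.1 hz).2
  have h1 := le_card_outs_union_outs (r := f) hT hzr
  rw [← hZ] at h1
  refine hasKTree_of_between hT hc hn hfr.symm hzr (adj_of_mem_insExcept hT hB' hz) (by omega)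
    hf (by simp [hB']) (by simp [hB']; omega) ?_ (by omega) ?_
  · have hd : Disjoint (T.outIn Z z) Yp := by
      rw [disjoint_left]
      intro x hx hx'
      exact hYZ x (mem_filter.1 hx').1 (mem_outIn.1 hx).1
    have hrX : r ∉ T.outIn Z z ∪ Yp := by simp [hZ, hYp, hY, hT.irrefl r]
    have h2 : insert r (T.outIn Z z ∪ Yp) ⊆ T.outs z := by
      intro x hx
      simp only [mem_insert, mem_union] at hx
      rcases hx with rfl | hx | hx
      · simpa using hzr
      · simpa using (mem_outIn.1 hx).2
      · simpa using hdom z hz x hx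
    have h3 := card_le_card h2
    rw [card_insert_of_notMem hrX, card_union_of_disjoint hd] at h3
    omega
  · have h2 := card_outs_add_card_le (T := T) (f := f) (E := (T.outs z).erase r) (X := Yp)
      (by
        intro x hx
        have := mem_insExcept.1 (mem_filter.1 hx).1
        simp [this.1, hdom z hz x hx])
      (fun x hx h => hT.asymm h (mem_insExcept.1 (mem_filter.1 hx).1).2)
    omega

/-- If `f` and a vertex `r` of maximum out-degree have at most one common in-neighbour and
`f` has at least four out-neighbours, then there is a spanning `4`-ary tree. -/
theorem hasKTree_of_card_commonIn_le_one (hT : T.IsTournament) (hc1 : 1 ≤ c) (hc : c ≤ 4)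
    (hn : Fintype.card V = 9 + c) {f r : V} (hfr : f ≠ r) (hf : 4 ≤ #(T.outs f))
    (hfr' : #(T.outs f) ≤ #(T.outs r)) (hr : 3 + c ≤ #(T.outs r)) (hr5 : 5 ≤ #(T.outs r))
    (hB : #(T.commonIn f r) ≤ 1) : HasKTree 4 T univ := by
  rcases Nat.le_one_iff_eq_zero_or_eq_one.1 hB with h | h
  · rw [card_eq_zero] at h
    by_cases hr4 : 4 + c ≤ #(T.outs r)
    · exact hasKTree_of_commonIn_eq_empty_of_large hT hc1 hc hn hfr hf hr4 h
    -- The two out-neighbourhoods cover `8 + c` vertices and `r` dominates `3 + c`, so `f` dominates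
    -- at least `5`.
    · have hu : #(T.outs f ∪ T.outs r) + #(T.commonIn f r) + 1 = Fintype.card V := by
        by_cases h : T.Adj f r
        · exact hT.card_outs_union h
        · rw [union_comm, commonIn_comm]
          exact hT.card_outs_union (hT.adj_of_not hfr h)
      have := card_union_le (T.outs f) (T.outs r)
      rw [h, card_empty] at hu
      exact hasKTree_of_commonIn_eq_empty_of_eq hT (by omega) hc hn hfr (by omega) hfr' (by omega) h
  · obtain ⟨w, hw⟩ := card_eq_one.1 h
    exact hasKTree_of_commonIn_eq_singleton hT hc1 hc hn hfr hf hr (by omega) hw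

/-- Take `w` as root: it dominates `f`, `r` and the other common in-neighbour `w'`, and `w'`
together with `f` (or `r`) gives the two extra vertices for Hall's condition. -/
theorem hasKTree_of_card_commonIn_eq_two (hT : T.IsTournament) (hc2 : 2 ≤ c) (hc : c ≤ 4)
    (hn : Fintype.card V = 9 + c) {f r w w' : V} (hfr : f ≠ r) (hf : 2 + c ≤ #(T.outs f))
    (hr : 2 + c ≤ #(T.outs r)) (hB : T.commonIn f r = {w, w'}) (hww : T.Adj w w')
    (hw : c ≤ #(T.outs w)) : HasKTree 4 T univ := by
  have h1 : w ∈ T.commonIn f r := by simp [hB]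
  have h2 : w' ∈ T.commonIn f r := by simp [hB]
  rw [mem_commonIn] at h1 h2
  have union : ∀ g, T.Adj w g → T.Adj w' g → 2 + c ≤ #(T.outs g) →
      4 + c ≤ #(T.outs g ∪ T.outs w) := by
    intro g hg hg' hgc
    have h3 := card_outs_add_card_le (T := T) (f := g) (E := T.outs w) (X := {g, w'})
      (by
        intro x hx
        rw [mem_insert, mem_singleton] at hx
        rcases hx with rfl | rfl
        · simpa using hg
        · simpa using hww)
      (by
        intro x hx
        rw [mem_insert, mem_singleton] at hx
        rcases hx with rfl | rfl
        · exact hT.irrefl _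
        · exact fun h => hT.asymm h hg')
    rw [card_pair (hT.ne hg').symm] at h3
    omega
  refine hasKTree_of_root_above hT hc hn hfr h1.1 h1.2 (by omega) (by omega) ?_ ?_ hw
    (union f h1.1 h2.1 hf) (union r h1.2 h2.2 hr)
  · intro x hx hxw
    rw [hB, mem_insert, mem_singleton] at hx
    rcases hx with rfl | rfl
    · exact absurd rfl hxw
    · exact hww
  · rw [hB]
    exact card_le_two.trans hc2

/-- Here `w` dominates only `f`, `r` and `w'`, so it is too poor to be the root; but then each
further in-neighbour of `w'` also dominates `w`, and one of these serves as third non-leaf. -/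
theorem hasKTree_of_card_commonIn_eq_two_of_le_three (hT : T.IsTournament)
    (hn : Fintype.card V = 13) {f r w w' : V} (hfr : f ≠ r) (hf : 6 ≤ #(T.outs f))
    (hr : 6 ≤ #(T.outs r)) (hB : T.commonIn f r = {w, w'}) (hww : T.Adj w w')
    (hw : #(T.outs w) ≤ 3) (hw' : #(T.outs w') ≤ 7) : HasKTree 4 T univ := by
  have h1 : w ∈ T.commonIn f r := by simp [hB]
  have h2 : w' ∈ T.commonIn f r := by simp [hB]
  rw [mem_commonIn] at h1 h2
  have hout : T.outs w = {f, r, w'} := by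
    symm
    apply eq_of_subset_of_card_le
    · intro x hx
      simp only [mem_insert, mem_singleton] at hx
      rcases hx with rfl | rfl | rfl
      · simpa using h1.1
      · simpa using h1.2
      · simpa using hww
    · rw [card_insert_of_notMem (by simp [hfr, (hT.ne h2.1).symm]),
        card_pair (hT.ne h2.2).symm]
      exact hw
  set X : Finset V := {x | x ≠ w ∧ x ≠ f ∧ x ≠ r ∧ T.Adj x w'} with hX
  have hXw : ∀ x ∈ X, T.Adj x w := by
    intro x hx
    obtain ⟨a1, a2, a3, a4⟩ := (mem_filter.1 hx).2
    refine hT.adj_of_not a1.symm fun h => ?_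
    have : x ∈ T.outs w := by simpa using h
    rw [hout] at this
    simp only [mem_insert, mem_singleton] at this
    rcases this with rfl | rfl | rfl
    · exact a2 rfl
    · exact a3 rfl
    · exact hT.irrefl _ a4
  have hXc : 4 ≤ #X := by
    have h3 : (univ : Finset V) ⊆ X ∪ (T.outs w' ∪ {w, w'}) := by
      intro x _
      by_cases hxw : x = w
      · simp [hxw]
      by_cases hxw' : x = w'
      · simp [hxw']
      by_cases h : T.Adj w' x
      · simp [h]
      have h' := hT.adj_of_not (Ne.symm hxw') h
      have hxf : x ≠ f := by rintro rfl; exact h h2.1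
      have hxr : x ≠ r := by rintro rfl; exact h h2.2
      exact mem_union_left _ (by simp [hX, hxw, hxf, hxr, h'])
    have h4 := card_le_card h3
    have h5 := card_union_le X (T.outs w' ∪ {w, w'})
    have h6 := card_union_le (T.outs w') {w, w'}
    have h7 : #({w, w'} : Finset V) ≤ 2 := card_le_two
    rw [card_univ] at h4
    omega
  obtain ⟨q, hq, hq2⟩ := hT.exists_card_le_outIn (S := X) (card_pos.1 (by omega))
  obtain ⟨-, hqf, hqr, hqw'⟩ := (mem_filter.1 hq).2
  have hw'X : w' ∉ T.outIn X q := by simp [hX, hT.irrefl w']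
  have hwX : w ∉ insert w' (T.outIn X q) := by simp [hX, hT.ne hww]
  have union : ∀ g, T.Adj w g → T.Adj w' g → 6 ≤ #(T.outs g) →
      4 + 4 ≤ #(T.outs g ∪ insert w (insert w' (T.outIn X q))) := by
    intro g hg hg' hgc
    have h3 := card_outs_add_card_le (T := T) (f := g)
      (E := insert w (insert w' (T.outIn X q))) (X := {w, w'})
      (by
        intro x hx
        rw [mem_insert, mem_singleton] at hx
        rcases hx with rfl | rfl <;> simp)
      (by
        intro x hx
        rw [mem_insert, mem_singleton] at hx
        rcases hx with rfl | rfl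
        · exact fun h => hT.asymm h hg
        · exact fun h => hT.asymm h hg')
    rw [card_pair (hT.ne hww)] at h3
    omega
  refine hasKTree_of_outside (c := 4) hT le_rfl hn hfr hqf hqr (by omega) (by omega)
    (E := insert w (insert w' (T.outIn X q))) ?_ ?_ ?_ ?_ ?_ ?_ (union f h1.1 h2.1 hf)
    (union r h1.2 h2.2 hr)
  · intro x hx
    simp only [mem_insert] at hx
    rcases hx with rfl | rfl | hx
    · exact hXw q hq
    · exact hqw'
    · exact (mem_outIn.1 hx).2
  · simp [hX, (hT.ne h1.1).symm, (hT.ne h2.1).symm]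
  · simp [hX, (hT.ne h1.2).symm, (hT.ne h2.2).symm]
  · rw [hB]
    intro x hx
    simp only [mem_insert, mem_singleton] at hx ⊢
    tauto
  · rw [hB]
    exact card_le_two.trans (by omega)
  · rw [card_insert_of_notMem hwX, card_insert_of_notMem hw'X]
    omega

end

end Digraph

/-! ### Degree bounds without a tree, and the regular case -/

namespace Digraph

section

open Classical

variable {V : Type*} [Fintype V] {T : Digraph V} {c : ℕ}

theorem IsTournament.exists_commonIn_eq_pair (hT : T.IsTournament) {f r : V}
    (hB : #(T.commonIn f r) = 2) : ∃ w w', T.commonIn f r = {w, w'} ∧ T.Adj w w' := by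
  obtain ⟨w, w', hne, h⟩ := card_eq_two.1 hB
  by_cases hw : T.Adj w w'
  · exact ⟨w, w', h, hw⟩
  · exact ⟨w', w, by rw [h, pair_comm], hT.adj_of_not hne hw⟩

/-- One common in-neighbour dominates `f`, `r` and the other one, so its out-degree is at least `3`,
and can be below `c` only if `c = 4`. -/
theorem IsTournament.card_outs_le_of_card_commonIn_eq_two (hT : T.IsTournament) (hc2 : 2 ≤ c)
    (hc : c ≤ 4) (hn : Fintype.card V = 9 + c) {f r : V} (hfr : f ≠ r)
    (hr : 2 + c ≤ #(T.outs r)) (hB : #(T.commonIn f r) = 2) (hno : ¬ HasKTree 4 T univ) :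
    #(T.outs f) ≤ 1 + c ∨ c = 4 ∧ ∃ w, T.Adj w f ∧ T.Adj w r ∧ #(T.outs w) ≤ 3 := by
  by_contra h
  push Not at h
  obtain ⟨w, w', hww, hadj⟩ := hT.exists_commonIn_eq_pair hB
  have h1 : w ∈ T.commonIn f r := by simp [hww]
  have h2 : w' ∈ T.commonIn f r := by simp [hww]
  rw [mem_commonIn] at h1 h2
  apply hno
  refine hasKTree_of_card_commonIn_eq_two hT hc2 hc hn hfr (by omega) hr hww hadj ?_
  have h3 : {f, r, w'} ⊆ T.outs w := by
    intro x hx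
    simp only [mem_insert, mem_singleton] at hx
    rcases hx with rfl | rfl | rfl
    · simpa using h1.1
    · simpa using h1.2
    · simpa using hadj
  have h4 := card_le_card h3
  rw [card_insert_of_notMem (by simp [hfr, (hT.ne h2.1).symm]), card_pair (hT.ne h2.2).symm] at h4
  by_cases hc4 : c = 4
  · have := h.2 hc4 w h1.1 h1.2
    omega
  · omega

theorem IsTournament.card_outs_le_five_of_card_commonIn_eq_two (hT : T.IsTournament)
    (hn : Fintype.card V = 13) {f r : V} (hfr : f ≠ r) (hr : 6 ≤ #(T.outs r))
    (hmax : ∀ v, #(T.outs v) ≤ 7) (hB : #(T.commonIn f r) = 2) (hno : ¬ HasKTree 4 T univ) :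
    #(T.outs f) ≤ 5 := by
  by_contra h
  obtain ⟨w, w', hww, hadj⟩ := hT.exists_commonIn_eq_pair hB
  apply hno
  by_cases hw : 4 ≤ #(T.outs w)
  · exact hasKTree_of_card_commonIn_eq_two (c := 4) hT (by omega) le_rfl hn hfr (by omega) hr hww
      hadj hw
  · exact hasKTree_of_card_commonIn_eq_two_of_le_three hT hn hfr (by omega) hr hww hadj (by omega)
      (hmax w')

/-! ### Counting out-degrees relative to a vertex -/

/-- The in-neighbours of `r`. -/
noncomputable def ins (T : Digraph V) (r : V) : Finset V := {y | T.Adj y r}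

@[simp] theorem mem_ins {r x : V} : x ∈ T.ins r ↔ T.Adj x r := by simp [ins]

theorem IsTournament.univ_eq (hT : T.IsTournament) (r : V) :
    (univ : Finset V) = insert r (T.ins r ∪ T.outs r) := by
  symm
  rw [eq_univ_iff_forall]
  intro x
  by_cases hx : x = r
  · simp [hx]
  by_cases h : T.Adj r x
  · simp [h]
  · simp [hT.adj_of_not (Ne.symm hx) h]

theorem IsTournament.disjoint_ins_outs (hT : T.IsTournament) (r : V) :
    Disjoint (T.ins r) (T.outs r) := by
  rw [disjoint_left]
  intro x hx hx'
  exact hT.asymm (mem_ins.1 hx) (mem_outIn.1 hx').2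

theorem IsTournament.sum_univ_eq (hT : T.IsTournament) (r : V) (g : V → ℕ) :
    ∑ v, g v = g r + ∑ v ∈ T.ins r, g v + ∑ v ∈ T.outs r, g v := by
  rw [hT.univ_eq r, sum_insert (by simp [hT.irrefl r]), sum_union (hT.disjoint_ins_outs r),
    add_assoc]

theorem IsTournament.card_ins_add (hT : T.IsTournament) (r : V) :
    #(T.ins r) + #(T.outs r) + 1 = Fintype.card V := by
  have := hT.sum_univ_eq r fun _ => 1
  simp only [← card_eq_sum_ones, card_univ] at this
  omega

theorem IsTournament.card_outs_of_mem_ins (hT : T.IsTournament) {r s : V} (hs : s ∈ T.ins r) :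
    #(T.outs s) = 1 + #(T.outIn (T.ins r) s) + #(T.outIn (T.outs r) s) := by
  have h1 : T.outs s = insert r (T.outIn (T.ins r) s ∪ T.outIn (T.outs r) s) := by
    ext x
    have hx : x ∈ insert r (T.ins r ∪ T.outs r) := by rw [← hT.univ_eq r]; exact mem_univ x
    simp only [mem_insert, mem_union, mem_outIn, mem_univ, true_and] at hx ⊢
    constructor
    · intro h
      tauto
    · rintro (rfl | h | h)
      · exact mem_ins.1 hs
      · exact h.2
      · exact h.2
  have hd : Disjoint (T.outIn (T.ins r) s) (T.outIn (T.outs r) s) :=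
    disjoint_of_subset_left (outIn_subset _ _)
      (disjoint_of_subset_right (outIn_subset _ _) (hT.disjoint_ins_outs r))
  rw [h1, card_insert_of_notMem (by simp [hT.irrefl r]), card_union_of_disjoint hd]
  omega

theorem IsTournament.card_commonIn_of_mem_ins (hT : T.IsTournament) {r s : V} (hs : s ∈ T.ins r) :
    #(T.commonIn s r) + #(T.outIn (T.ins r) s) + 1 = #(T.ins r) := by
  have h1 : T.ins r = insert s (T.commonIn s r ∪ T.outIn (T.ins r) s) := by
    ext x
    simp only [mem_insert, mem_union, mem_outIn, mem_commonIn, mem_ins]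
    constructor
    · intro h
      by_cases hx : x = s
      · exact Or.inl hx
      by_cases hsx : T.Adj s x
      · exact Or.inr (Or.inr ⟨h, hsx⟩)
      · exact Or.inr (Or.inl ⟨hT.adj_of_not (Ne.symm hx) hsx, h⟩)
    · rintro (rfl | h | h)
      · exact mem_ins.1 hs
      · exact h.2
      · exact h.1
  have hd : Disjoint (T.commonIn s r) (T.outIn (T.ins r) s) := by
    rw [disjoint_left]
    intro x hx hx'
    exact hT.asymm (mem_commonIn.1 hx).1 (mem_outIn.1 hx').2
  conv_rhs => rw [h1]
  rw [card_insert_of_notMem (by simp [hT.irrefl s]), card_union_of_disjoint hd]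

theorem sum_card_commonIn (r : V) :
    ∑ x ∈ T.outs r, #(T.commonIn x r) = ∑ s ∈ T.ins r, #(T.outIn (T.outs r) s) := by
  have h := sum_card_bipartiteAbove_eq_sum_card_bipartiteBelow (s := T.ins r) (t := T.outs r) T.Adj
  have h1 : ∀ x, T.commonIn x r = (T.ins r).bipartiteBelow T.Adj x := by
    intro x
    ext y
    simp [bipartiteBelow, and_comm]
  simp only [h1]
  exact h.symm

/-- If all but one in-neighbours of `r` are in `K`, then every vertex that has two common
in-neighbours with `r` is dominated by an element of `K`. -/
theorem card_filter_two_le_commonIn_le {r : V} {K : Finset V} (hK : K ⊆ T.ins r)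
    (hKc : #(T.ins r) ≤ #K + 1) :
    #{x ∈ T.outs r | 2 ≤ #(T.commonIn x r)} ≤ ∑ s ∈ K, #(T.outIn (T.outs r) s) := by
  refine le_trans (card_le_card ?_) (card_biUnion_le (s := K) (t := fun s => T.outIn (T.outs r) s))
  intro x hx
  obtain ⟨hx1, hx2⟩ := mem_filter.1 hx
  by_contra hc
  have h1 : T.commonIn x r ⊆ T.ins r \ K := by
    intro y hy
    obtain ⟨h1, h2⟩ := mem_commonIn.1 hy
    refine mem_sdiff.2 ⟨mem_ins.2 h2, fun hyK => hc ?_⟩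
    exact mem_biUnion.2 ⟨y, hyK, mem_outIn.2 ⟨hx1, h1⟩⟩
  have h2 := card_le_card h1
  rw [card_sdiff_of_subset hK] at h2
  omega

theorem sum_le_of_filter {ι : Type*} (A : Finset ι) (g : ι → ℕ) (p : ι → Prop) [DecidablePred p]
    (m M : ℕ) (h1 : ∀ x ∈ A, ¬ p x → g x ≤ m) (h2 : ∀ x ∈ A, g x ≤ m + M) :
    ∑ x ∈ A, g x ≤ m * #A + M * #{x ∈ A | p x} := by
  calc ∑ x ∈ A, g x ≤ ∑ x ∈ A, (m + if p x then M else 0) := by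
        refine sum_le_sum fun x hx => ?_
        split_ifs with hp
        · exact h2 x hx
        · exact h1 x hx hp
    _ = m * #A + M * #{x ∈ A | p x} := by
        rw [sum_add_distrib, ← sum_filter, sum_const, sum_const, smul_eq_mul, smul_eq_mul,
          mul_comm m, mul_comm M]

/-! ### Regular tournaments of order thirteen -/

/-- Some in-neighbour `s` of `r` dominates at least three of the other five, so `s` and `r` have at
most two common in-neighbours. In each case the exact degrees determine enough of the structure to
find the third non-leaf. -/
theorem hasKTree_of_regular (hT : T.IsTournament) (hn : Fintype.card V = 13)
    (hreg : ∀ v, #(T.outs v) = 6) : HasKTree 4 T univ := by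
  obtain ⟨r⟩ : Nonempty V := Fintype.card_pos_iff.1 (by omega)
  have hI := hT.card_ins_add r
  rw [hreg] at hI
  obtain ⟨s, hs, hs1⟩ := hT.exists_card_le_outIn (S := T.ins r) (card_pos.1 (by omega))
  have hsr := mem_ins.1 hs
  have hd := hT.card_outs_of_mem_ins hs
  rw [hreg] at hd
  have hb := hT.card_commonIn_of_mem_ins hs
  have hb2 : #(T.commonIn s r) = 0 ∨ #(T.commonIn s r) = 1 ∨ #(T.commonIn s r) = 2 := by omega
  have hne := hT.ne hsr
  rcases hb2 with hb0 | hb1 | hb2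
  · rw [card_eq_zero] at hb0
    set J := T.outIn (T.ins r) s with hJ
    have hJc : #J = 5 := by
      rw [hb0, card_empty] at hb
      omega
    have hJs : ∀ x ∈ J, T.Adj x r ∧ T.Adj s x := by simp [hJ]
    -- An out-neighbour in `J` helps Hall's condition for `r`, while few of them leave at least two
    -- in `T.outs r`, which helps the one for `s`. If the first choice dominates all of `J`, a
    -- vertex below it is taken.
    obtain ⟨q, hq, hq1, hq3⟩ : ∃ q ∈ J, 1 ≤ #(T.outIn J q) ∧ #(T.outIn J q) ≤ 3 := by
      obtain ⟨q, hq, h1⟩ := hT.exists_card_le_outIn (S := J) (card_pos.1 (by omega))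
      by_cases h3 : #(T.outIn J q) ≤ 3
      · exact ⟨q, hq, by omega, h3⟩
      have hJq : T.outIn J q = J.erase q := by
        apply eq_of_subset_of_card_le
        · intro x hx
          obtain ⟨h1, h2⟩ := mem_outIn.1 hx
          exact mem_erase.2 ⟨(hT.ne h2).symm, h1⟩
        · rw [card_erase_of_mem hq]; omega
      have hJe : #(J.erase q) = 4 := by rw [card_erase_of_mem hq]; omega
      obtain ⟨y, hy, hy1⟩ := hT.exists_card_le_outIn (S := J.erase q) (card_pos.1 (by omega))
      have hqy : T.Adj q y := by rw [← hJq] at hy; exact (mem_outIn.1 hy).2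
      have hyJ := (mem_erase.1 hy).2
      have e1 : T.outIn (J.erase q) y ⊆ T.outIn J y := by
        intro x hx
        obtain ⟨h1, h2⟩ := mem_outIn.1 hx
        exact mem_outIn.2 ⟨(mem_erase.1 h1).2, h2⟩
      have e2 : T.outIn J y ⊆ (J.erase q).erase y := by
        intro x hx
        obtain ⟨h1, h2⟩ := mem_outIn.1 hx
        exact mem_erase.2 ⟨(hT.ne h2).symm, mem_erase.2
          ⟨by rintro rfl; exact hT.asymm hqy h2, h1⟩⟩
      have e3 := card_le_card e1
      have e4 := card_le_card e2
      rw [card_erase_of_mem hy] at e4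
      exact ⟨y, hyJ, by omega, by omega⟩
    obtain ⟨hqr, hsq⟩ := hJs q hq
    have hdq := hT.card_outs_of_mem_ins (mem_ins.2 hqr)
    rw [hreg] at hdq
    have e1 : T.outIn (T.ins r) q ⊆ T.outIn J q := by
      intro x hx
      obtain ⟨h1, h2⟩ := mem_outIn.1 hx
      refine mem_outIn.2 ⟨mem_outIn.2 ⟨h1, ?_⟩, h2⟩
      have hxs : x ≠ s := by rintro rfl; exact hT.asymm hsq h2
      by_contra h
      have : x ∈ T.commonIn s r := mem_commonIn.2 ⟨hT.adj_of_not hxs.symm h, mem_ins.1 h1⟩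
      simp [hb0] at this
    have e2 := card_le_card e1
    have hsout : T.outIn (T.outs r) s = ∅ := by rw [← card_eq_zero]; omega
    refine hasKTree_of_root_dominating (c := 4) hT le_rfl hn hsr (hT.ne hsq).symm (hT.ne hqr)
      (by rw [hreg]; omega) (by rw [hreg]; omega) (E := T.outs q) (by simp)
      (by simpa using fun h => hT.asymm h hsq) (by simp [hb0]) (by simp [hb0])
      (by rw [hreg]; omega) ?_ ?_
    · have h1 := card_outs_add_card_le (T := T) (f := s) (E := T.outs q)
        (X := T.outIn (T.outs r) q) (fun x hx => by simpa using (mem_outIn.1 hx).2)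
        (by
          intro x hx h
          have : x ∈ T.outIn (T.outs r) s := mem_outIn.2 ⟨(mem_outIn.1 hx).1, h⟩
          simp [hsout] at this)
      rw [hreg] at h1
      omega
    · have hrX : r ∉ T.outIn J q := by simp [hJ, hT.irrefl r]
      have h1 := card_outs_add_card_le (T := T) (f := r) (E := T.outs q)
        (X := insert r (T.outIn J q))
        (by
          intro x hx
          rcases mem_insert.1 hx with rfl | hx
          · simpa using hqr
          · simpa using (mem_outIn.1 hx).2)
        (by
          intro x hx
          rcases mem_insert.1 hx with rfl | hx
          · exact hT.irrefl _
          · exact fun h => hT.asymm h (hJs x (mem_outIn.1 hx).1).1)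
      rw [hreg, card_insert_of_notMem hrX] at h1
      omega
  · obtain ⟨w, hw⟩ := card_eq_one.1 hb1
    have hw' : w ∈ T.commonIn s r := by simp [hw]
    obtain ⟨hws, hwr⟩ := mem_commonIn.1 hw'
    by_cases hz : ∃ z, T.Adj w z ∧ z ≠ s ∧ ¬ T.Adj s z
    · obtain ⟨z, hwz, hzs, hsz⟩ := hz
      refine hasKTree_of_root_above (c := 4) hT le_rfl hn hne hws hwr (by rw [hreg]; omega)
        (by rw [hreg]; omega) (fun x hx hxw => ?_) (by omega) (by rw [hreg]; omega) ?_ ?_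
      · rw [hw, mem_singleton] at hx
        exact absurd hx hxw
      · have h1 := card_outs_add_card_le (T := T) (f := s) (E := T.outs w) (X := {s, z})
          (by
            intro x hx
            rw [mem_insert, mem_singleton] at hx
            rcases hx with rfl | rfl
            · simpa using hws
            · simpa using hwz)
          (by
            intro x hx
            rw [mem_insert, mem_singleton] at hx
            rcases hx with rfl | rfl
            · exact hT.irrefl _
            · exact hsz)
        rw [hreg, card_pair hzs.symm] at h1
        omega
      · have h1 := card_outs_add_card_le (T := T) (f := r) (E := T.outs w) (X := {r, s})
          (by
            intro x hx
            rw [mem_insert, mem_singleton] at hx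
            rcases hx with rfl | rfl
            · simpa using hwr
            · simpa using hws)
          (by
            intro x hx
            rw [mem_insert, mem_singleton] at hx
            rcases hx with rfl | rfl
            · exact hT.irrefl _
            · exact fun h => hT.asymm h hsr)
        rw [hreg, card_pair hne.symm] at h1
        omega
    push Not at hz
    set X : Finset V := T.outs r \ T.outIn (T.outs r) s with hX
    have hXc : #X = 5 := by
      rw [hX, card_sdiff_of_subset (outIn_subset _ _), hreg]
      omega
    have hXs : ∀ x ∈ X, T.Adj r x ∧ T.Adj x s := by
      intro x hx
      obtain ⟨h1, h2⟩ := mem_sdiff.1 hx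
      have hrx := (mem_outIn.1 h1).2
      exact ⟨hrx, hT.adj_of_not (by rintro rfl; exact hT.asymm hsr hrx)
        fun h => h2 (mem_outIn.2 ⟨h1, h⟩)⟩
    have hXw : ∀ x ∈ X, T.Adj x w := by
      intro x hx
      obtain ⟨h1, h2⟩ := hXs x hx
      exact hT.adj_of_not (by rintro rfl; exact hT.asymm hwr h1)
        fun h => hT.asymm h2 (hz x h (hT.ne h2))
    set J := T.outIn (T.ins r) s with hJ
    have hJs : ∀ x ∈ J, T.Adj x r ∧ T.Adj s x := by simp [hJ]
    by_cases hxj : ∃ x ∈ X, ∃ j ∈ J, T.Adj x j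
    · obtain ⟨x, hx, j, hj, hxj⟩ := hxj
      obtain ⟨hjr, hsj⟩ := hJs j hj
      obtain ⟨hrx, hxs⟩ := hXs x hx
      have hxw := hXw x hx
      have hwj : w ≠ j := by rintro rfl; exact hT.asymm hws hsj
      refine hasKTree_of_between (c := 4) hT le_rfl hn hne hxs hrx (by rw [hreg]; omega)
        (by rw [hreg]; omega) (fun y hy => ?_) (by omega) (by rw [hreg]; omega) ?_ ?_
      · rw [hw, mem_singleton] at hy
        rw [hy]
        exact hxw
      · have h1 := card_outs_add_card_le (T := T) (f := s) (E := T.outs x) (X := {s, w})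
          (by
            intro y hy
            rw [mem_insert, mem_singleton] at hy
            rcases hy with rfl | rfl
            · simpa using hxs
            · simpa using hxw)
          (by
            intro y hy
            rw [mem_insert, mem_singleton] at hy
            rcases hy with rfl | rfl
            · exact hT.irrefl _
            · exact fun h => hT.asymm h hws)
        rw [hreg, card_pair (hT.ne hws).symm] at h1
        omega
      · have h1 := card_outs_add_card_le (T := T) (f := r) (E := (T.outs x).erase s) (X := {w, j})
          (by
            intro y hy
            rw [mem_insert, mem_singleton] at hy
            rcases hy with rfl | rfl
            · simpa using ⟨hT.ne hws, hxw⟩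
            · simpa using ⟨(hT.ne hsj).symm, hxj⟩)
          (by
            intro y hy
            rw [mem_insert, mem_singleton] at hy
            rcases hy with rfl | rfl
            · exact fun h => hT.asymm h hwr
            · exact fun h => hT.asymm h hjr)
        rw [hreg, card_pair hwj] at h1
        omega
    push Not at hxj
    -- Now every vertex of `J` dominates `r` and the five vertices of `X`, which exhausts its
    -- out-degree; but some arc lies inside `J`.
    obtain ⟨j, hj, hj1⟩ := hT.exists_card_le_outIn (S := J) (card_pos.1 (by omega))
    obtain ⟨j', hj'⟩ := card_pos.1 (show 0 < #(T.outIn J j) by omega)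
    obtain ⟨hj'J, hjj'⟩ := mem_outIn.1 hj'
    have hrX : r ∉ X := fun h => hT.irrefl r (hXs r h).1
    have hout : insert r X = T.outs j := by
      apply eq_of_subset_of_card_le
      · intro x hx
        rcases mem_insert.1 hx with rfl | hx
        · simpa using (hJs j hj).1
        · have : T.Adj j x := hT.adj_of_not
            (by rintro rfl; exact hT.asymm (hXs _ hx).1 (hJs _ hj).1) (hxj x hx j hj)
          simpa using this
      · rw [hreg, card_insert_of_notMem hrX, hXc]
    have hj'' : j' ∈ insert r X := by rw [hout]; simpa using hjj'
    have hj'r := (hJs j' hj'J).1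
    rcases mem_insert.1 hj'' with h | h
    · exact absurd hj'r (h ▸ hT.irrefl j')
    · exact absurd hj'r fun h' => hT.asymm h' (hXs j' h).1
  · obtain ⟨w, w', hww, hadj⟩ := hT.exists_commonIn_eq_pair hb2
    exact hasKTree_of_card_commonIn_eq_two (c := 4) hT (by omega) le_rfl hn hne
      (by rw [hreg]) (by rw [hreg]) hww hadj (by rw [hreg]; omega)

end

end Digraph

/-! ### The count of arcs in a tournament without a tree -/

namespace Digraph

section

open Classical

variable {V : Type*} [Fintype V] {T : Digraph V} {c : ℕ}

/-- `T` is a tournament of order `9 + c` without spanning `4`-ary tree, and `r` is a vertex of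
maximum out-degree, which is at least five. -/
structure IsSparseAt (T : Digraph V) (c : ℕ) (r : V) : Prop where
  isTournament : T.IsTournament
  one_le : 1 ≤ c
  le_four : c ≤ 4
  card_eq : Fintype.card V = 9 + c
  card_outs_le : ∀ v, #(T.outs v) ≤ #(T.outs r)
  five_le : 5 ≤ #(T.outs r)
  not_hasKTree : ¬ HasKTree 4 T univ

namespace IsSparseAt

variable {r : V}

theorem card_ins_add (h : T.IsSparseAt c r) : #(T.ins r) + #(T.outs r) = 8 + c := by
  have := h.isTournament.card_ins_add r
  rw [h.card_eq] at this
  omega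

theorem ne_of_mem_ins (h : T.IsSparseAt c r) {s : V} (hs : s ∈ T.ins r) : s ≠ r :=
  h.isTournament.ne (mem_ins.1 hs)

theorem ne_of_mem_outs (h : T.IsSparseAt c r) {s : V} (hs : s ∈ T.outs r) : s ≠ r :=
  (h.isTournament.ne (mem_outIn.1 hs).2).symm

/-- Through this bound the absence of a tree enters the count; at most five in-neighbours means that
`r` has out-degree at least `3 + c`. -/
theorem card_outs_le_three (h : T.IsSparseAt c r) (hI : #(T.ins r) ≤ 5) {f : V} (hf : f ≠ r)
    (hB : #(T.commonIn f r) ≤ 1) : #(T.outs f) ≤ 3 := by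
  by_contra hc
  have := h.card_ins_add
  exact h.not_hasKTree (hasKTree_of_card_commonIn_le_one h.isTournament h.one_le h.le_four
    h.card_eq hf (by omega) (h.card_outs_le f) (by omega) h.five_le hB)

theorem card_outs_le_three_of_mem_ins (h : T.IsSparseAt c r) (hI : #(T.ins r) ≤ 5) {s : V}
    (hs : s ∈ T.ins r) (ho : #(T.ins r) ≤ #(T.outIn (T.ins r) s) + 2) : #(T.outs s) ≤ 3 := by
  have := h.isTournament.card_commonIn_of_mem_ins hs
  exact h.card_outs_le_three hI (h.ne_of_mem_ins hs) (by omega)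

theorem sum_outs_le (h : T.IsSparseAt c r) (hI : #(T.ins r) ≤ 5) :
    ∑ x ∈ T.outs r, #(T.outs x) ≤ 3 * #(T.outs r) +
      (#(T.outs r) - 3) * #{x ∈ T.outs r | 2 ≤ #(T.commonIn x r)} := by
  have h5 := h.five_le
  refine sum_le_of_filter _ _ _ _ _ (fun x hx hp => ?_) fun x _ => ?_
  · exact h.card_outs_le_three hI (h.ne_of_mem_outs hx) (by omega)
  · have := h.card_outs_le x
    omega

theorem card_mul_eq (h : T.IsSparseAt c r) : (9 + c) * (8 + c) = 2 * (#(T.outs r) +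
    ∑ s ∈ T.ins r, #(T.outs s) + ∑ x ∈ T.outs r, #(T.outs x)) := by
  rw [← h.isTournament.sum_univ_eq r fun v => #(T.outs v), h.isTournament.sum_card_outIn,
    card_univ, h.card_eq]
  congr 1
  omega

theorem card_ins_ne_zero (h : T.IsSparseAt c r) : #(T.ins r) ≠ 0 := by
  intro hI
  have h1 := h.card_ins_add
  have h2 := h.card_mul_eq
  have h3 := h.sum_outs_le (by omega)
  have h4 := card_filter_two_le_commonIn_le (T := T) (r := r) (K := ∅) (by simp) (by omega)
  rw [card_eq_zero] at hI
  rw [hI, sum_empty] at h2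
  rw [sum_empty, Nat.le_zero] at h4
  rw [h4] at h3
  obtain ⟨hc1, hc4⟩ := And.intro h.one_le h.le_four
  interval_cases c <;> omega

theorem card_ins_ne_one (h : T.IsSparseAt c r) : #(T.ins r) ≠ 1 := by
  intro hI
  have h1 := h.card_ins_add
  have h2 := h.card_mul_eq
  have h3 := h.sum_outs_le (by omega)
  have h4 := card_filter_two_le_commonIn_le (T := T) (r := r) (K := ∅) (by simp) (by omega)
  have h5 : ∑ s ∈ T.ins r, #(T.outs s) ≤ #(T.ins r) * 3 :=
    sum_le_card_nsmul _ _ _ fun s hs => h.card_outs_le_three_of_mem_ins (by omega) hs (by omega)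
  rw [sum_empty, Nat.le_zero] at h4
  rw [h4] at h3
  obtain ⟨hc1, hc4⟩ := And.intro h.one_le h.le_four
  interval_cases c <;> omega

/-- An in-neighbour of `r` has out-degree at most `3`, one of which goes to `r`. So at most two
vertices have two common in-neighbours with `r`, and only these can have large out-degree. -/
theorem card_ins_ne_two (h : T.IsSparseAt c r) : #(T.ins r) ≠ 2 := by
  intro hI
  have h1 := h.card_ins_add
  have h2 := h.card_mul_eq
  have h3 := h.sum_outs_le (by omega)
  have h5 : ∀ s ∈ T.ins r, #(T.outs s) ≤ 3 := fun s hs =>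
    h.card_outs_le_three_of_mem_ins (by omega) hs (by omega)
  have h6 : ∑ s ∈ T.ins r, #(T.outs s) ≤ #(T.ins r) * 3 := sum_le_card_nsmul _ _ _ h5
  obtain ⟨s, hs⟩ := card_pos.1 (show 0 < #(T.ins r) by omega)
  have h4 := card_filter_two_le_commonIn_le (T := T) (K := {s}) (by simpa using hs)
    (by rw [hI, card_singleton])
  rw [sum_singleton] at h4
  have h7 := h.isTournament.card_outs_of_mem_ins hs
  have h8 := h5 s hs
  have h9 : #{x ∈ T.outs r | 2 ≤ #(T.commonIn x r)} ≤ 2 := by omega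
  have h10 := Nat.mul_le_mul_left (#(T.outs r) - 3) h9
  obtain ⟨hc1, hc4⟩ := And.intro h.one_le h.le_four
  interval_cases c <;> omega

/-- At least two in-neighbours of `r` dominate another one. They have out-degree at most `3`, hence
at most one out-neighbour in `T.outs r`, so again at most two vertices there can have large
out-degree. -/
theorem card_ins_ne_three (h : T.IsSparseAt c r) : #(T.ins r) ≠ 3 := by
  intro hI
  have hT := h.isTournament
  have h1 := h.card_ins_add
  have h2 := h.card_mul_eq
  have h3 := h.sum_outs_le (by omega)
  have hlow := hT.card_filter_outIn_le (T.ins r) 0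
  have hsplit := card_filter_add_card_filter_not (s := T.ins r)
    (fun s => #(T.outIn (T.ins r) s) ≤ 0)
  obtain ⟨K, hK, hKc⟩ := exists_subset_card_eq
    (show 2 ≤ #{s ∈ T.ins r | ¬ #(T.outIn (T.ins r) s) ≤ 0} by omega)
  have hKI : K ⊆ T.ins r := hK.trans (filter_subset _ _)
  have hK1 : ∀ s ∈ K, #(T.outs s) ≤ 3 ∧ #(T.outIn (T.outs r) s) ≤ 1 := by
    intro s hs
    have e1 := (mem_filter.1 (hK hs)).2
    have e2 := hT.card_outs_of_mem_ins (hKI hs)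
    have e3 := h.card_outs_le_three_of_mem_ins (by omega) (hKI hs) (by omega)
    omega
  have h4 := card_filter_two_le_commonIn_le (T := T) hKI (by omega)
  have h5 : ∑ s ∈ K, #(T.outIn (T.outs r) s) ≤ #K * 1 :=
    sum_le_card_nsmul _ _ _ fun s hs => (hK1 s hs).2
  have h6 : ∑ s ∈ K, #(T.outs s) ≤ #K * 3 := sum_le_card_nsmul _ _ _ fun s hs => (hK1 s hs).1
  have h7 : ∑ s ∈ T.ins r \ K, #(T.outs s) ≤ #(T.ins r \ K) * #(T.outs r) :=
    sum_le_card_nsmul _ _ _ fun s _ => h.card_outs_le s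
  have h8 := sum_sdiff (f := fun s => #(T.outs s)) hKI
  rw [card_sdiff_of_subset hKI, hI, hKc] at h7
  have h9 : #{x ∈ T.outs r | 2 ≤ #(T.commonIn x r)} ≤ 2 := by omega
  have h10 := Nat.mul_le_mul_left (#(T.outs r) - 3) h9
  obtain ⟨hc1, hc4⟩ := And.intro h.one_le h.le_four
  interval_cases c <;> omega

/-- Nobody dominates three in-neighbours of `r`, so at least two of the four dominate exactly two
others. These form `P`; they have out-degree at most `3` and thus send nothing to `T.outs r`. -/
theorem card_ins_ne_four (h : T.IsSparseAt c r) : #(T.ins r) ≠ 4 := by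
  intro hI
  have hT := h.isTournament
  have h1 := h.card_ins_add
  have h2 := h.card_mul_eq
  have h3 := h.sum_outs_le (by omega)
  have hsum := hT.sum_card_outIn (T.ins r)
  rw [hI] at hsum
  have ho2 : ∀ s ∈ T.ins r, #(T.outIn (T.ins r) s) ≤ 2 := by
    intro s hs
    by_contra hc
    have e1 := hT.card_outs_of_mem_ins hs
    have e2 := h.card_outs_le_three_of_mem_ins (by omega) hs (by omega)
    omega
  set P : Finset V := {s ∈ T.ins r | #(T.outIn (T.ins r) s) = 2} with hP
  have hPI : P ⊆ T.ins r := filter_subset _ _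
  have hP1 : ∀ s ∈ P, #(T.outs s) ≤ 3 ∧ #(T.outIn (T.outs r) s) = 0 := by
    intro s hs
    have e1 := (mem_filter.1 hs).2
    have e2 := hT.card_outs_of_mem_ins (hPI hs)
    have e3 := h.card_outs_le_three_of_mem_ins (by omega) (hPI hs) (by omega)
    omega
  have hP2 : 2 ≤ #P := by
    have e := sum_le_of_filter (T.ins r) (fun s => #(T.outIn (T.ins r) s))
      (fun s => #(T.outIn (T.ins r) s) = 2) 1 1 (fun s hs hp => by have := ho2 s hs; omega)
      (fun s hs => ho2 s hs)
    rw [← hP, hI] at e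
    omega
  have h6 : ∑ s ∈ T.ins r, #(T.outs s) ≤ 6 + 2 * #(T.outs r) := by
    obtain ⟨K, hK, hKc⟩ := exists_subset_card_eq hP2
    have hKI := hK.trans hPI
    have e6 : ∑ s ∈ K, #(T.outs s) ≤ #K * 3 :=
      sum_le_card_nsmul _ _ _ fun s hs => (hP1 s (hK hs)).1
    have e7 : ∑ s ∈ T.ins r \ K, #(T.outs s) ≤ #(T.ins r \ K) * #(T.outs r) :=
      sum_le_card_nsmul _ _ _ fun s _ => h.card_outs_le s
    have e8 := sum_sdiff (f := fun s => #(T.outs s)) hKI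
    rw [card_sdiff_of_subset hKI, hI, hKc] at e7
    omega
  have hsumP : ∑ s ∈ P, #(T.outIn (T.outs r) s) = 0 := sum_eq_zero fun s hs => (hP1 s hs).2
  -- a bound from one vertex outside `P`
  have hbound : ∀ t ∈ T.ins r, t ∉ P → #{x ∈ T.outs r | 2 ≤ #(T.commonIn x r)} ≤
      #(T.outIn (T.outs r) t) := by
    intro t ht htP
    have e := card_filter_two_le_commonIn_le (T := T) (K := insert t P)
      (insert_subset ht hPI) (by rw [card_insert_of_notMem htP]; omega)
    rwa [sum_insert htP, hsumP, add_zero] at e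
  have hβ2 : ∀ x ∈ T.outs r, #(T.commonIn x r) ≤ 2 := by
    intro x hx
    have e : T.commonIn x r ⊆ T.ins r \ P := by
      intro y hy
      obtain ⟨e1, e2⟩ := mem_commonIn.1 hy
      refine mem_sdiff.2 ⟨mem_ins.2 e2, fun hyP => ?_⟩
      have e3 := (hP1 y hyP).2
      rw [card_eq_zero] at e3
      have e4 : x ∈ T.outIn (T.outs r) y := mem_outIn.2 ⟨hx, e1⟩
      simp [e3] at e4
    have e' := card_le_card e
    rw [card_sdiff_of_subset hPI] at e'
    omega
  have hsumA : ∀ m, (∀ x ∈ T.outs r, #(T.outs x) ≤ m) →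
      ∑ x ∈ T.outs r, #(T.outs x) ≤ #(T.outs r) * m := fun m hm => sum_le_card_nsmul _ _ _ hm
  have hc1 := h.one_le
  have hc4 := h.le_four
  -- For small `c`, bounding how many vertices have two common in-neighbours with `r` suffices. For
  -- larger `c` their degrees are bounded by `1 + c`, unless a common in-neighbour of out-degree at
  -- most `3` occurs, which then limits their number to two.
  by_cases hc2 : c ≤ 2
  · have hh : #{x ∈ T.outs r | 2 ≤ #(T.commonIn x r)} ≤ #(T.outs r) - 2 := by
      by_cases hP3 : 3 ≤ #P
      · have e := card_filter_two_le_commonIn_le (T := T) hPI (by omega)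
        omega
      · have e1 := sum_sdiff (f := fun s => #(T.outIn (T.ins r) s)) hPI
        have e2 : ∑ s ∈ P, #(T.outIn (T.ins r) s) ≤ #P * 2 :=
          sum_le_card_nsmul _ _ _ fun s hs => ho2 s (hPI hs)
        obtain ⟨t, ht, ht0⟩ := exists_ne_zero_of_sum_ne_zero
          (show ∑ s ∈ T.ins r \ P, #(T.outIn (T.ins r) s) ≠ 0 by omega)
        obtain ⟨htI, htP⟩ := mem_sdiff.1 ht
        have e3 := hbound t htI htP
        have e4 := hT.card_outs_of_mem_ins htI
        have e5 := h.card_outs_le t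
        omega
    have h10 := Nat.mul_le_mul_left (#(T.outs r) - 3) hh
    have : #(T.outs r) = 4 + c := by omega
    rw [this] at h2 h3 h6 h10
    interval_cases c <;> omega
  have key : ∀ x ∈ T.outs r, #(T.outs x) ≤ 1 + c ∨ c = 4 ∧ ∃ w, T.Adj w x ∧ T.Adj w r ∧
      #(T.outs w) ≤ 3 := by
    intro x hx
    by_cases e : #(T.commonIn x r) = 2
    · exact hT.card_outs_le_of_card_commonIn_eq_two (by omega) hc4 h.card_eq (h.ne_of_mem_outs hx)
        (by omega) e h.not_hasKTree
    · have := hβ2 x hx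
      have := h.card_outs_le_three (by omega) (h.ne_of_mem_outs hx) (by omega)
      omega
  by_cases hall : ∀ x ∈ T.outs r, #(T.outs x) ≤ 1 + c
  · have e := hsumA _ hall
    have : #(T.outs r) = 4 + c := by omega
    rw [this] at h2 h6 e
    interval_cases c <;> omega
  · push Not at hall
    obtain ⟨x, hx, hxc⟩ := hall
    obtain ⟨hc', w, hwx, hwr, hw3⟩ := (key x hx).resolve_left (by omega)
    have hwA : x ∈ T.outIn (T.outs r) w := mem_outIn.2 ⟨hx, hwx⟩
    have hwP : w ∉ P := by
      intro hw
      have e3 := (hP1 w hw).2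
      rw [card_eq_zero] at e3
      simp [e3] at hwA
    have e1 := hbound w (mem_ins.2 hwr) hwP
    have e2 := hT.card_outs_of_mem_ins (mem_ins.2 hwr)
    have hh : #{x ∈ T.outs r | 2 ≤ #(T.commonIn x r)} ≤ 2 := by omega
    have h10 := Nat.mul_le_mul_left (#(T.outs r) - 3) hh
    subst hc'
    omega

/-- The in-neighbours of `r` form a regular tournament, so each has two common in-neighbours with
`r` and out-degree at most `c + 1`. They send few arcs into `T.outs r`, so few vertices there have
three common in-neighbours with `r`, and only those can exceed `c + 1`. -/
theorem card_ins_ne_five (h : T.IsSparseAt c r) : #(T.ins r) ≠ 5 := by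
  intro hI
  have hT := h.isTournament
  have h1 := h.card_ins_add
  have h2 := h.card_mul_eq
  have h5 := h.five_le
  have hc4 := h.le_four
  have hsum := hT.sum_card_outIn (T.ins r)
  rw [hI] at hsum
  have ho2 : ∀ s ∈ T.ins r, #(T.outIn (T.ins r) s) ≤ 2 := by
    intro s hs
    by_contra hc
    have e1 := hT.card_outs_of_mem_ins hs
    have e2 := h.card_outs_le_three_of_mem_ins (by omega) hs (by omega)
    omega
  have ho : ∀ s ∈ T.ins r, #(T.outIn (T.ins r) s) = 2 := by
    refine (sum_eq_sum_iff_of_le ho2).1 ?_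
    rw [sum_const, smul_eq_mul, hI]
    omega
  have hβ : ∀ s ∈ T.ins r, #(T.commonIn s r) = 2 := by
    intro s hs
    have e1 := hT.card_commonIn_of_mem_ins hs
    have e2 := ho s hs
    omega
  have two : ∀ x, x ≠ r → #(T.commonIn x r) = 2 → #(T.outs x) ≤ c + 1 := by
    intro x hx hx2
    by_cases hc : c = 4
    · subst hc
      exact hT.card_outs_le_five_of_card_commonIn_eq_two h.card_eq hx (by omega)
        (fun v => (h.card_outs_le v).trans (by omega)) hx2 h.not_hasKTree
    · have e := hT.card_outs_le_of_card_commonIn_eq_two (by omega) hc4 h.card_eq hx (by omega) hx2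
        h.not_hasKTree
      omega
  have hd : ∀ s ∈ T.ins r, #(T.outs s) ≤ c + 1 ∧ #(T.outIn (T.outs r) s) ≤ c - 2 := by
    intro s hs
    have e1 := two s (h.ne_of_mem_ins hs) (hβ s hs)
    have e2 := hT.card_outs_of_mem_ins hs
    have e3 := ho s hs
    omega
  have h6 : ∑ s ∈ T.ins r, #(T.outs s) ≤ #(T.ins r) * (c + 1) :=
    sum_le_card_nsmul _ _ _ fun s hs => (hd s hs).1
  have h7 : ∑ s ∈ T.ins r, #(T.outIn (T.outs r) s) ≤ #(T.ins r) * (c - 2) :=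
    sum_le_card_nsmul _ _ _ fun s hs => (hd s hs).2
  have h8 := sum_card_commonIn (T := T) r
  have h9 : #{x ∈ T.outs r | 3 ≤ #(T.commonIn x r)} * 3 ≤ ∑ x ∈ T.outs r, #(T.commonIn x r) :=
    (card_nsmul_le_sum {x ∈ T.outs r | 3 ≤ #(T.commonIn x r)} (fun x => #(T.commonIn x r)) 3
      fun x hx => (mem_filter.1 hx).2).trans (sum_le_sum_of_subset (filter_subset _ _))
  have h10 := sum_le_of_filter (T.outs r) (fun x => #(T.outs x))
    (fun x => 3 ≤ #(T.commonIn x r)) (c + 1) 2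
    (fun x hx hp => by
      by_cases e : #(T.commonIn x r) = 2
      · exact two x (h.ne_of_mem_outs hx) e
      · have := h.card_outs_le_three (by omega) (h.ne_of_mem_outs hx) (by omega)
        omega)
    (fun x _ => by have := h.card_outs_le x; omega)
  have : #(T.outs r) = 3 + c := by omega
  rw [this] at h2 h10
  rw [hI] at h6 h7
  have hc2 : 2 ≤ c := by omega
  interval_cases c <;> omega

end IsSparseAt

theorem hasKTree_four_of_card (hT : T.IsTournament) (hc1 : 1 ≤ c) (hc : c ≤ 4)
    (hn : Fintype.card V = 9 + c) : HasKTree 4 T univ := by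
  by_contra hno
  have huniv : (univ : Finset V).Nonempty := card_pos.1 (by rw [card_univ]; omega)
  obtain ⟨r, -, hr⟩ := exists_max_image univ (fun v => #(T.outs v)) huniv
  obtain ⟨v, hv, hv1⟩ := hT.exists_card_le_outIn huniv
  rw [card_univ, hn] at hv1
  have hvr : #(T.outs v) ≤ #(T.outs r) := hr v hv
  have h : T.IsSparseAt c r := ⟨hT, hc1, hc, hn, fun v => hr v (mem_univ v), by
    have : #(T.outIn univ v) = #(T.outs v) := rfl
    omega, hno⟩
  have h1 := h.card_ins_add
  have h2 : #(T.outIn univ v) = #(T.outs v) := rfl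
  by_cases hI : #(T.ins r) ≤ 5
  · have e0 := h.card_ins_ne_zero
    have e1 := h.card_ins_ne_one
    have e2 := h.card_ins_ne_two
    have e3 := h.card_ins_ne_three
    have e4 := h.card_ins_ne_four
    have e5 := h.card_ins_ne_five
    omega
  -- Six in-neighbours of `r` mean that the maximum out-degree equals the average `6`, so the
  -- tournament is regular.
  · obtain rfl : c = 4 := by omega
    apply hno
    refine hasKTree_of_regular hT hn ?_
    have hsum : 2 * ∑ v, #(T.outs v) = _ := hT.sum_card_outIn univ
    rw [card_univ, hn] at hsum
    have hle : ∀ v ∈ univ, #(T.outs v) ≤ 6 := fun v hv => (hr v hv).trans (by omega)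
    have heq := (sum_eq_sum_iff_of_le hle).1 (by
      rw [sum_const, smul_eq_mul, card_univ, hn]
      omega)
    exact fun v => heq v (mem_univ v)

end

end Digraph

/-! ### Conclusion -/

namespace Digraph

open Classical in
theorem IsTournament.hasKTree_four {V : Type*} {T : Digraph V} (hT : T.IsTournament) (n : ℕ) :
    ∀ S : Finset V, #S = n → 10 ≤ n → HasKTree 4 T S := by
  induction n using Nat.strong_induction_on with
  | _ n ih =>
  intro S hS hn
  -- Removing a star lowers the order by `4`, so the four orders from `10` to `13` are the base.
  by_cases h : n ≤ 13
  · refine HasKTree.of_subtype ?_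
    have := hasKTree_four_of_card (c := n - 9) (hT.subtype S) (by omega) (by omega)
      (by rw [Fintype.card_coe]; omega)
    convert this
  · exact hasKTree_of_forall_card_sub hT (by omega) (by omega) fun S' _ hS' =>
      ih #S' (by omega) S' rfl (by omega)

theorem everyTournamentHasKArySpanningTree_four_ten : EveryTournamentHasKArySpanningTree 4 10 := by
  classical
  intro V _ hV T hT
  exact HasKTree.hasKArySpanningTree (hT.hasKTree_four _ univ rfl (by rwa [card_univ]))

end Digraph

theorem theorem3 : hNum 4 = 10 ∧ 13 ≤ hNum 5 := by
  have h4 := Digraph.everyTournamentHasKArySpanningTree_four_ten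
  refine ⟨le_antisymm (Nat.sInf_le h4) (ten_le_of_everyTournament_four ?_),
    thirteen_le_of_everyTournament_five ?_⟩
  · exact Nat.sInf_mem (s := {N | EveryTournamentHasKArySpanningTree 4 N}) ⟨10, h4⟩
  -- The infimum belongs to the set only because the set is nonempty; this is where existence for `k
  -- = 5` is used.
  · exact Nat.sInf_mem (s := {N | EveryTournamentHasKArySpanningTree 5 N})
      (Digraph.exists_everyTournamentHasKArySpanningTree (by omega))
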